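/- **Setting.** Let $d\ge 2$, let $T=([d],E)$ be a tree with a chosen root, and for $k\in[d]$ let $\mathcal C(k)$, $\mathcal P(k)$, $\mathcal N(k)$, $\mathcal L(k)$, $\mathcal R(k)$ be the children, parent, neighbours, descendants, and the vertices outside $\mathcal L(k)\cup\{k\}$. A *leaf* is a vertex without children. Let $n_k$ $(k\in[d])$ be physical dimensions and $r_e,l_e,m_e$ $(e\in E)$ bond dimensions; write $r_k=r_{(k,\mathcal P(k))}$, $x_S=(x_v)_{v\in S}$, and $\alpha_{(k,S)}=(\alpha_{(k,w)})_{w\in S}$. At the root, an index $\alpha,\beta,\gamma$ of the (missing) edge $(k,\mathcal P(k))$ takes one value only; at a leaf, an index of the (missing) edges $(k,\mathcal C(k))$ takes one value only. *Tensor cores* with bond dimensions $r$ are real tensors $G_k(x_k,\alpha_{(k,\mathcal N(k))})$, and they are *TTNS cores of* $p$ if $$p(x_1,\dots,x_d)=\sum_{(\alpha_e)_{e\in E}}\ \prod_{k=1}^d G_k(x_k,\alpha_{(k,\mathcal N(k))}).$$ The norm $\|\cdot\|$ of a matrix is the spectral norm, $\sigma_j$ its $j$-th largest singular value, $\dagger$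 the Moore–Penrose pseudoinverse; a semicolon separates row from column indices. The 3-tensor norm of a core is $|||G_k|||=\max_{x}\|G_k(\alpha_{(k,\mathcal C(k))};x;\alpha_{(k,\mathcal P(k))})\|$, the largest spectral norm of the matrix obtained by fixing $x_k=x$. Let $p^\star:\prod_k[n_k]\to\mathbb R$ be a probability density ($p^\star\ge0$, $\sum_x p^\star(x)=1$) satisfying the TTNS condition: for every non-root $w$ there are $\Phi_w(x_{\mathcal L(w)\cup w};\alpha)$ and $\Psi_w(\alpha;x_{\mathcal R(w)})$, $\alpha\in[r_w]$, with $p^\star=\sum_{\alpha}\Phi_w\Psi_w$. Let $\hat p:\prod_k[n_k]\to\mathbb R$ be any real tensor (for instance the empirical distribution of a sample). **Sketches.** Let $s_k$ and $t_k$ be tensor cores with physical dimensions $n$ and bond dimensions $l$ and $m$ respectively. For $S\subset[d]$ let $f_S$ (resp. $g_S$) be the function of $x_S$ and of the bond indices on the edges with exactly one end in $S$ obtained from $\prod_{k\in S}s_k$ (resp. $\prod_{k\in S}t_k$) by summing over the bond indices of the edges inside $S$. Put $S_k=f_{\mathcal L(k)}$, $T_k=g_{\mathcal R(k)}$, and for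 $w\in\mathcal C(k)$ $$S_{w\to k}(\beta_{(w,k)},x_{\mathcal L(w)\cup w})=\sum_{\beta_{(w,\mathcal C(w))}}s_w(x_w,\beta_{(w,k)},\beta_{(w,\mathcal C(w))})\,S_w(\beta_{(w,\mathcal C(w))},x_{\mathcal L(w)}).$$ For a tensor $p$ let $$Z_k(\beta_{(k,\mathcal C(k))},x_k;\gamma_{(k,\mathcal P(k))})=\sum_{x_{\mathcal L(k)\cup\mathcal R(k)}}S_k\,p\,T_k,\qquad Z_{w\to k}(\beta_{(w,k)};\gamma_{(w,k)})=\sum_{x}S_{w\to k}\,p\,T_w .$$ Assume that for every family $(\Phi_w,\Psi_w)_w$ as in the TTNS condition for $p^\star$: (i) for every non-root $k$ the matrices $\sum_{x_{\mathcal R(k)}}p^\star(x)T_k(x_{\mathcal R(k)},\gamma)$ (rows $x_{\mathcal L(k)\cup k}$, columns $\gamma$) and $\Phi_k$ have the same column space, of dimension $r_k$; (ii) for every $k$ that is neither a leaf nor the root, $Z_k$ formed from $p^\star$ has rank $r_k$; (iii) for every non-leaf $k$ the matrix $\prod_{w\in\mathcal C(k)}\sum_{x_{\mathcal L(w)\cup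 w}}S_{w\to k}(\beta_{(w,k)},x_{\mathcal L(w)\cup w})\Phi_w(x_{\mathcal L(w)\cup w},\alpha_{(w,k)})$ with rows $\beta_{(k,\mathcal C(k))}$ and columns $\alpha_{(k,\mathcal C(k))}$ has full column rank. **Algorithm.** For a tensor $p$: for every non-root $k$ let $U_k\Sigma_kV_k^\top$ be a best rank-$r_k$ approximation of $Z_k$ obtained from a truncated SVD, and put $Q_k=V_k\Sigma_k^{-1}$, $B_k=U_k$; at the root put $B_k=Z_k$. For non-leaf $k$ put $A_k(\beta_{(k,\mathcal C(k))};\alpha_{(k,\mathcal C(k))})=\prod_{w\in\mathcal C(k)}\sum_{\gamma}Z_{w\to k}(\beta_{(w,k)},\gamma)Q_w(\gamma,\alpha_{(w,k)})$. The output is $G_k=B_k$ for a leaf $k$, and otherwise $G_k$ is a least-squares solution of $$\sum_{\alpha_{(k,\mathcal C(k))}}A_k(\beta_{(k,\mathcal C(k))},\alpha_{(k,\mathcal C(k))})\,G_k(x_k,\alpha_{(k,\mathcal N(k))})=B_k(\beta_{(k,\mathcal C(k))},x_k,\alpha_{(k,\mathcal P(k))}).$$ Let $Z_k^\star,A_k^\star,G_k^\star$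 and $\hat Z_k,\hat A_k,\hat G_k$ arise in this way from $p^\star$ and $\hat p$ (for any choice of the truncated SVDs and least-squares solutions). **Constants.** Let $c_{\mathcal C}=\max_i|\mathcal C(i)|$; $c_{k;Z}=1$ if $k$ is the root and $c_{k;Z}=\sigma_{r_k}(Z_k^\star)$ otherwise; $c_{k;G}=1/|||G_k^\star|||$; $c_{k;A}=c_{k;S}=1$ if $k$ is a leaf, and otherwise $c_{k;A}=\|(A_k^\star)^\dagger\|$ and $c_{k;S}=\prod_{w\in\mathcal C(k)}\|s_w(\beta_{(w,k)};\beta_{(w,\mathcal C(w))},x_w)\|$. Put $$\xi=\min\Bigl\{1,\ \min_{i\in[d]}\bigl(2c_{i;A}(c_{i;S}+c_{i;G})\bigr)^{-1}\Bigr\},\qquad \zeta_k=\Bigl(6\,\frac{c_{\mathcal C}}{c_{k;Z}}\Bigr)^{-1}\xi .$$ **Theorem (Error bound over TTNS tensor cores).** Let $\delta\in(0,1)$ and suppose $\|Z_k^\star-\hat Z_k\|\le\zeta_k\delta$ for every $k\in[d]$, with both sketches unfolded as $Z_k(\beta_{(k,\mathcal C(k))},x_k;\gamma_{(k,\mathcal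 P(k))})$. Then there are orthogonal matrices $R_k\in\mathrm O(r_k)$, with $R_k=1$ at the root, such that the rotated cores $$G_k^\circ(x_k,\alpha_{(k,\mathcal C(k))},\alpha_{(k,\mathcal P(k))})=\sum_{\alpha'_{(k,\mathcal C(k))},\,\alpha'_{(k,\mathcal P(k))}}\Bigl(\prod_{w\in\mathcal C(k)}R_w^\top(\alpha_{(w,k)},\alpha'_{(w,k)})\Bigr)G_k^\star(x_k,\alpha'_{(k,\mathcal C(k))},\alpha'_{(k,\mathcal P(k))})\,R_k(\alpha'_{(k,\mathcal P(k))},\alpha_{(k,\mathcal P(k))})$$ are TTNS cores of $p^\star$, and for every $k\in[d]$ $$|||G_k^\circ|||=|||G_k^\star|||>0,\qquad |||\hat G_k-G_k^\circ|||\le\delta\,|||G_k^\circ||| .$$ -/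

import Mathlib

open scoped Matrix Matrix.Norms.L2Operator

noncomputable section

/-! ### Matrices -/

/-- The four Penrose equations: `X` is the Moore–Penrose pseudoinverse of the real matrix `A`. -/
structure IsMoorePenrose {m n : Type*} [Fintype m] [Fintype n]
    (A : Matrix m n ℝ) (X : Matrix n m ℝ) : Prop where
  mul_mul_left : A * X * A = A
  mul_mul_right : X * A * X = X
  symm_left : (A * X)ᵀ = A * X
  symm_right : (X * A)ᵀ = X * A

theorem exists_isMoorePenrose {m n : Type*} [Fintype m] [Fintype n] [DecidableEq n]
    (A : Matrix m n ℝ) : ∃ X : Matrix n m ℝ, IsMoorePenrose A X := by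
  have hH : (Aᵀ * A).IsHermitian := by
    simp [Matrix.IsHermitian, Matrix.conjTranspose_eq_transpose_of_trivial]
  set U : Matrix n n ℝ := (hH.eigenvectorUnitary : Matrix n n ℝ) with hU
  have hUU : Uᵀ * U = 1 := by
    have := Matrix.mem_unitaryGroup_iff'.1 hH.eigenvectorUnitary.2
    simpa [Matrix.star_eq_conjTranspose, Matrix.conjTranspose_eq_transpose_of_trivial] using this
  set D := hH.eigenvalues
  have hspec : Aᵀ * A = U * Matrix.diagonal D * Uᵀ := by
    have := hH.spectral_theorem
    simpa [Unitary.conjStarAlgAut_apply, Matrix.star_eq_conjTranspose,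
      Matrix.conjTranspose_eq_transpose_of_trivial, Function.comp_def] using this
  set K : Matrix n n ℝ := U * Matrix.diagonal (fun i => (D i)⁻¹) * Uᵀ with hK
  have hKt : Kᵀ = K := by simp [hK, Matrix.transpose_mul, Matrix.mul_assoc]
  have hmul : ∀ a b : n → ℝ, (U * Matrix.diagonal a * Uᵀ) * (U * Matrix.diagonal b * Uᵀ)
      = U * Matrix.diagonal (fun i => a i * b i) * Uᵀ := by
    intro a b
    calc _ = U * Matrix.diagonal a * (Uᵀ * U) * Matrix.diagonal b * Uᵀ := by
          simp only [Matrix.mul_assoc]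
      _ = _ := by
          rw [hUU, Matrix.mul_one, Matrix.mul_assoc U, Matrix.diagonal_mul_diagonal]
  set P : Matrix n n ℝ := K * (Aᵀ * A) with hP
  have hPt : Pᵀ = P := by
    rw [hP, hK, hspec, hmul]; simp [Matrix.transpose_mul, Matrix.mul_assoc]
  have hHP : Aᵀ * A * P = Aᵀ * A := by
    rw [hP, hK, hspec, hmul, hmul]
    congr 3; ext i; rcases eq_or_ne (D i) 0 with h | h <;> simp [h]
  have hPK : P * K = K := by
    rw [hP, hspec, hK, hmul, hmul]
    congr 3; ext i; rcases eq_or_ne (D i) 0 with h | h <;> simp [h]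
  have hAP : A * P = A := by
    have h0 : (A * P - A)ᵀ * (A * P - A) = 0 := by
      have e : Aᵀ * (A * P - A) = 0 := by
        rw [Matrix.mul_sub, ← Matrix.mul_assoc, hHP, sub_self]
      rw [Matrix.transpose_sub, Matrix.transpose_mul, Matrix.sub_mul, Matrix.mul_assoc, e]
      simp
    have h1 : (A * P - A)ᴴ * (A * P - A) = 0 := by
      rwa [Matrix.conjTranspose_eq_transpose_of_trivial]
    exact sub_eq_zero.1 (Matrix.conjTranspose_mul_self_eq_zero.1 h1)
  refine ⟨K * Aᵀ, ?_, ?_, ?_, ?_⟩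
  · calc A * (K * Aᵀ) * A = A * P := by simp only [hP, Matrix.mul_assoc]
      _ = A := hAP
  · calc K * Aᵀ * A * (K * Aᵀ) = P * K * Aᵀ := by simp only [hP, Matrix.mul_assoc]
      _ = K * Aᵀ := by rw [hPK]
  · simp [Matrix.transpose_mul, hKt, Matrix.mul_assoc]
  · rw [Matrix.mul_assoc]; exact hPt

/-- The Moore–Penrose pseudoinverse `A†`. -/
def pinv {m n : Type*} [Fintype m] [Fintype n] [DecidableEq n]
    (A : Matrix m n ℝ) : Matrix n m ℝ :=
  (exists_isMoorePenrose A).choose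

theorem pinv_isMoorePenrose {m n : Type*} [Fintype m] [Fintype n] [DecidableEq n]
    (A : Matrix m n ℝ) : IsMoorePenrose A (pinv A) :=
  (exists_isMoorePenrose A).choose_spec

/-- `σ_j(M)`, the `j`-th largest singular value, with `j = 1, 2, …`. -/
def sigma {m n : Type*} [Fintype m] [DecidableEq m] [Fintype n] [DecidableEq n]
    (j : ℕ) (M : Matrix m n ℝ) : ℝ :=
  (Matrix.toEuclideanLin M).singularValues (j - 1)

/-- `X` solves `A X = B` in the least-squares sense: it minimises `‖A X - B‖_F`. -/
def IsLeastSquares {m n q : Type*} [Fintype m] [Fintype n] [Fintype q]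
    (A : Matrix m n ℝ) (B : Matrix m q ℝ) (X : Matrix n q ℝ) : Prop :=
  ∀ Y : Matrix n q ℝ, ∑ i, ∑ j, (A * X - B) i j ^ 2 ≤ ∑ i, ∑ j, (A * Y - B) i j ^ 2

/-- `U diag(σ) Vᵀ` is a best rank-`r` approximation of `Z` obtained by truncating a singular value
decomposition of `Z`: the columns of `U` and `V` are orthonormal left and right singular vectors
with singular values `σ`, and no singular value of the remainder exceeds one of those kept. -/
structure IsTruncatedSVD {m n : Type*} [Fintype m] [Fintype n] [DecidableEq n] {r : ℕ}
    (Z : Matrix m n ℝ) (U : Matrix m (Fin r) ℝ) (σ : Fin r → ℝ) (V : Matrix n (Fin r) ℝ) :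
    Prop where
  orthonormal_left : Uᵀ * U = 1
  orthonormal_right : Vᵀ * V = 1
  nonneg : ∀ i, 0 ≤ σ i
  mul_right : Z * V = U * Matrix.diagonal σ
  mul_left : Zᵀ * U = V * Matrix.diagonal σ
  remainder_le : ∀ i, ‖Z - U * Matrix.diagonal σ * Vᵀ‖ ≤ σ i

/-! ### Rooted trees -/

structure TTNSTree (V : Type*) where
  graph : SimpleGraph V
  isTree : graph.IsTree
  root : V

namespace TTNSTree

variable {V : Type*} [Fintype V] [DecidableEq V] (τ : TTNSTree V)

/-- The vertex following `v` on the path from `v` to the root, i.e. the parent of `v` if `v` is not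
the root (and the root itself if `v` is the root). -/
def parent (v : V) : V :=
  (τ.isTree.existsUnique_path v τ.root).choose.snd

/-- `C(k)`, the children of `k`. -/
def children (k : V) : Finset V :=
  Finset.univ.filter fun w => w ≠ τ.root ∧ τ.parent w = k

def IsLeaf (k : V) : Prop := τ.children k = ∅

open Classical in
/-- `L(k)`, the (proper) descendants of `k`. -/
def left (k : V) : Finset V :=
  Finset.univ.filter fun v => Relation.TransGen (fun a b => a ∈ τ.children b) v k

/-- `L(k) ∪ k`. -/
def subtree (k : V) : Finset V := insert k (τ.left k)

/-- `R(k)`, the vertices outside the subtree at `k`. -/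
def right (k : V) : Finset V := (τ.subtree k)ᶜ

/-- The bonds touching the vertex set `S`. The bond `(e, P(e))` is labelled by its child end `e`;
the label `τ.root` stands for a dummy bond above the root. -/
def incident (S : Finset V) : Finset V := S ∪ S.biUnion τ.children

/-- `∂S`: the edges with exactly one end in `S`, labelled by their child ends. -/
def boundary (S : Finset V) : Finset V :=
  Finset.univ.filter fun e => e ≠ τ.root ∧ ¬(e ∈ S ↔ τ.parent e ∈ S)

theorem mem_children {w k : V} : w ∈ τ.children k ↔ w ≠ τ.root ∧ τ.parent w = k := by
  simp [children]

theorem mem_left {v k : V} :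
    v ∈ τ.left k ↔ Relation.TransGen (fun a b => a ∈ τ.children b) v k := by
  simp [left]

theorem mem_subtree_self (k : V) : k ∈ τ.subtree k := Finset.mem_insert_self _ _

theorem left_subset_subtree (k : V) : τ.left k ⊆ τ.subtree k := Finset.subset_insert _ _

theorem mem_incident_self {S : Finset V} {k : V} (hk : k ∈ S) : k ∈ τ.incident S :=
  Finset.mem_union_left _ hk

theorem mem_incident_child {S : Finset V} {k w : V} (hk : k ∈ S) (hw : w ∈ τ.children k) :
    w ∈ τ.incident S :=
  Finset.mem_union_right _ (Finset.mem_biUnion.2 ⟨k, hk, hw⟩)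

theorem boundary_subset_incident (S : Finset V) : τ.boundary S ⊆ τ.incident S := by
  intro e he
  simp only [boundary, Finset.mem_filter, Finset.mem_univ, true_and] at he
  by_cases h : e ∈ S
  · exact τ.mem_incident_self h
  · exact τ.mem_incident_child (k := τ.parent e) (by tauto) (τ.mem_children.2 ⟨he.1, rfl⟩)

theorem mem_left_iff_parent {e k : V} (he : e ≠ τ.root) :
    e ∈ τ.left k ↔ τ.parent e ∈ τ.subtree k := by
  have hc : e ∈ τ.children (τ.parent e) := τ.mem_children.2 ⟨he, rfl⟩
  rw [subtree, Finset.mem_insert, mem_left, mem_left]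
  constructor
  · intro h
    obtain ⟨b, hb, h⟩ := Relation.TransGen.head'_iff.1 h
    obtain rfl := (τ.mem_children.1 hb).2
    rcases Relation.reflTransGen_iff_eq_or_transGen.1 h with h | h
    · exact .inl h.symm
    · exact .inr h
  · rintro (h | h)
    · exact .single (h ▸ hc)
    · exact .head hc h

theorem boundary_left_subset (k : V) : τ.boundary (τ.left k) ⊆ τ.children k := by
  intro e he
  simp only [boundary, Finset.mem_filter, Finset.mem_univ, true_and] at he
  obtain ⟨h0, h⟩ := he
  rw [τ.mem_left_iff_parent h0, subtree, Finset.mem_insert] at h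
  exact τ.mem_children.2 ⟨h0, by tauto⟩

theorem eq_of_mem_boundary_right {k e : V} (he : e ∈ τ.boundary (τ.right k)) : e = k := by
  simp only [boundary, right, Finset.mem_filter, Finset.mem_univ, true_and,
    Finset.mem_compl] at he
  obtain ⟨h0, h⟩ := he
  rw [← τ.mem_left_iff_parent h0, subtree, Finset.mem_insert] at h
  tauto

end TTNSTree

/-! ### Tensors over a rooted tree -/

section TTNS

variable {V : Type*} [Fintype V] [DecidableEq V] (τ : TTNSTree V)

/-- A joint index `x_S`, where the index at `v` runs over `[n v]`. It is used both for the physical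
variables `x_S` and for the bond variables, a bond being labelled by its child end. -/
abbrev Joint (n : V → ℕ) (S : Finset V) : Type _ := ∀ v : S, Fin (n v)

/-- Real tensors on `∏_v [n v]`. -/
abbrev Tensor (n : V → ℕ) : Type _ := (∀ v, Fin (n v)) → ℝ

/-- The restriction `x_S` of a full joint index. -/
def res {n : V → ℕ} (S : Finset V) (x : ∀ v, Fin (n v)) : Joint n S := fun v => x v

/-- Tensor cores at `k`, `G (x_k, α_{(k, C(k))}, α_{(k, P(k))})`, with physical dimensions `n` and
bond dimensions `r`, where `r e` belongs to the edge `(e, P(e))`. With `r τ.root = 1` the last index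
at the root, and with `C(k) = ∅` the middle index at a leaf, takes a single value. -/
abbrev Core (n r : V → ℕ) (k : V) : Type _ :=
  Fin (n k) → Joint r (τ.children k) → Fin (r k) → ℝ

/-- `p` admits a TTNS ansatz over the tensor cores `G`. -/
def IsTTNS {n r : V → ℕ} (p : Tensor n) (G : ∀ k, Core τ n r k) : Prop :=
  ∀ x, p x = ∑ α : (∀ v, Fin (r v)), ∏ k, G k (x k) (res (τ.children k) α) (α k)

/-- A family `Φ_{w → P(w)}`, `Ψ_{w → P(w)}` (for `w` not the root) of factorisations of `p` along
the edges, with `r w` terms at the edge `(w, P(w))`. -/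
def IsLowRankDecomposition {n r : V → ℕ} (p : Tensor n)
    (Φ : ∀ w, Matrix (Joint n (τ.subtree w)) (Fin (r w)) ℝ)
    (Ψ : ∀ w, Matrix (Fin (r w)) (Joint n (τ.right w)) ℝ) : Prop :=
  ∀ w, w ≠ τ.root → ∀ x, p x = ∑ a, Φ w (res (τ.subtree w) x) a * Ψ w a (res (τ.right w) x)

/-- The TTNS condition with bond ranks `r`. -/
def TTNSCondition {n : V → ℕ} (r : V → ℕ) (p : Tensor n) : Prop :=
  ∃ (Φ : ∀ w, Matrix (Joint n (τ.subtree w)) (Fin (r w)) ℝ)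
    (Ψ : ∀ w, Matrix (Fin (r w)) (Joint n (τ.right w)) ℝ), IsLowRankDecomposition τ p Φ Ψ

/-- The 3-tensor norm: the largest spectral norm of a slice `G(·; x; ·)`, with the bonds to the
children as rows and the bond to the parent as column. -/
def triNorm {n r : V → ℕ} {k : V} (G : Core τ n r k) : ℝ :=
  ⨆ x : Fin (n k), ‖(Matrix.of (G x) : Matrix (Joint r (τ.children k)) (Fin (r k)) ℝ)‖

/-- The core `G` viewed as the matrix `G(α_{(k, C(k))}; x_k, α_{(k, P(k))})`. -/
def coreMatrix {n r : V → ℕ} {k : V} (G : Core τ n r k) :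
    Matrix (Joint r (τ.children k)) (Fin (n k) × Fin (r k)) ℝ :=
  Matrix.of fun α i => G i.1 α i.2

/-- The core `s` viewed as the matrix `s(β_{(k, P(k))}; β_{(k, C(k))}, x_k)`. -/
def sketchCoreMatrix {n l : V → ℕ} {k : V} (s : Core τ n l k) :
    Matrix (Fin (l k)) (Joint l (τ.children k) × Fin (n k)) ℝ :=
  Matrix.of fun b i => s i.2 i.1 b

/-- The subgraph TTNS function `f_S(x_S, b_{∂S})` of the cores `s`: the cores at the vertices in `S`
are contracted over the bonds inside `S`, and the bonds in `∂S` are held fixed. -/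
def subTTNS {n l : V → ℕ} (s : ∀ k, Core τ n l k) (S : Finset V)
    (x : Joint n S) (b : Joint l (τ.boundary S)) : ℝ :=
  ∑ β : Joint l (τ.incident S) with
      ∀ e : τ.boundary S, β ⟨e, τ.boundary_subset_incident S e.2⟩ = b e,
    ∏ k : S, s k (x k) (fun w => β ⟨w, τ.mem_incident_child k.2 w.2⟩)
      (β ⟨k, τ.mem_incident_self k.2⟩)

/-! ### Recursive sketch functions -/

/-- The left sketch `S_k = f_{L(k)}`, where `f` has the cores `s`. -/
def leftSketch {n l : V → ℕ} (s : ∀ k, Core τ n l k) (k : V)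
    (β : Joint l (τ.children k)) (x : Joint n (τ.left k)) : ℝ :=
  subTTNS τ s (τ.left k) x fun e => β ⟨e, τ.boundary_left_subset k e.2⟩

/-- The factor `S_{w → P(w)}` of the left sketch at the parent of `w`. -/
def edgeSketch {n l : V → ℕ} (s : ∀ k, Core τ n l k) (w : V)
    (b : Fin (l w)) (x : Joint n (τ.subtree w)) : ℝ :=
  ∑ β : Joint l (τ.children w), s w (x ⟨w, τ.mem_subtree_self w⟩) β b *
    leftSketch τ s w β fun v => x ⟨v, τ.left_subset_subtree w v.2⟩

/-- The right sketch `T_k = g_{R(k)}`, where `g` has the cores `t` (so `T_k = 1` at the root). -/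
def rightSketch {n m : V → ℕ} (t : ∀ k, Core τ n m k) (k : V)
    (x : Joint n (τ.right k)) (c : Fin (m k)) : ℝ :=
  subTTNS τ t (τ.right k) x fun e =>
    Fin.cast (congrArg m (τ.eq_of_mem_boundary_right e.2).symm) c

/-- The sketch `Z_k(β_{(k, C(k))}, x_k; γ_{(k, P(k))})` of `p`. -/
def sketchZ {n l m : V → ℕ} (s : ∀ k, Core τ n l k) (t : ∀ k, Core τ n m k) (p : Tensor n)
    (k : V) : Matrix (Joint l (τ.children k) × Fin (n k)) (Fin (m k)) ℝ :=
  Matrix.of fun i c => ∑ x : (∀ v, Fin (n v)) with x k = i.2,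
    leftSketch τ s k i.1 (res (τ.left k) x) * p x * rightSketch τ t k (res (τ.right k) x) c

/-- The sketch `Z_{w → P(w)}(β_{(w, P(w))}; γ_{(w, P(w))})` of `p`. -/
def sketchEdgeZ {n l m : V → ℕ} (s : ∀ k, Core τ n l k) (t : ∀ k, Core τ n m k) (p : Tensor n)
    (w : V) : Matrix (Fin (l w)) (Fin (m w)) ℝ :=
  Matrix.of fun b c => ∑ x : (∀ v, Fin (n v)),
    edgeSketch τ s w b (res (τ.subtree w) x) * p x * rightSketch τ t w (res (τ.right w) x) c

/-- `Φ̄_k(x_{L(k) ∪ k}; γ_{(k, P(k))})`: the tensor `p` sketched from the right only. -/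
def rightSketched {n m : V → ℕ} (t : ∀ k, Core τ n m k) (p : Tensor n) (k : V) :
    Matrix (Joint n (τ.subtree k)) (Fin (m k)) ℝ :=
  Matrix.of fun y c => ∑ x : (∀ v, Fin (n v)) with res (τ.subtree k) x = y,
    p x * rightSketch τ t k (res (τ.right k) x) c

/-- `A^Δ_k(β_{(k, C(k))}; α_{(k, C(k))})` for given left factors `Φ`. -/
def gaugeA {n l r : V → ℕ} (s : ∀ k, Core τ n l k)
    (Φ : ∀ w, Matrix (Joint n (τ.subtree w)) (Fin (r w)) ℝ) (k : V) :
    Matrix (Joint l (τ.children k)) (Joint r (τ.children k)) ℝ :=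
  Matrix.of fun β α => ∏ w : τ.children k,
    ∑ y : Joint n (τ.subtree w), edgeSketch τ s w (β w) y * Φ w y (α w)

/-- The condition on the sketch functions under which the sketched equations for the cores of `p`
are uniquely solvable. -/
structure SketchCondition {n l m : V → ℕ} (r : V → ℕ) (s : ∀ k, Core τ n l k)
    (t : ∀ k, Core τ n m k) (p : Tensor n) : Prop where
  same_range : ∀ (Φ : ∀ w, Matrix (Joint n (τ.subtree w)) (Fin (r w)) ℝ)
    (Ψ : ∀ w, Matrix (Fin (r w)) (Joint n (τ.right w)) ℝ), IsLowRankDecomposition τ p Φ Ψ →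
    ∀ k, k ≠ τ.root →
      LinearMap.range (rightSketched τ t p k).mulVecLin = LinearMap.range (Φ k).mulVecLin ∧
      (Φ k).rank = r k
  rank_sketchZ : ∀ k, ¬ τ.IsLeaf k → k ≠ τ.root → (sketchZ τ s t p k).rank = r k
  full_column_rank : ∀ (Φ : ∀ w, Matrix (Joint n (τ.subtree w)) (Fin (r w)) ℝ)
    (Ψ : ∀ w, Matrix (Fin (r w)) (Joint n (τ.right w)) ℝ), IsLowRankDecomposition τ p Φ Ψ →
    ∀ k, ¬ τ.IsLeaf k → (gaugeA τ s Φ k).rank = Fintype.card (Joint r (τ.children k))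

/-! ### The algorithm -/

/-- A choice of `U_k`, `Σ_k = diag(σ_k)`, `V_k` for every `k` (the root values are not used). -/
structure SVDChoice (n l m r : V → ℕ) where
  U : ∀ k, Matrix (Joint l (τ.children k) × Fin (n k)) (Fin (r k)) ℝ
  σ : ∀ k, Fin (r k) → ℝ
  V : ∀ k, Matrix (Fin (m k)) (Fin (r k)) ℝ

variable {τ} in
/-- `Q_k = V_k Σ_k⁻¹`. -/
def SVDChoice.Q {n l m r : V → ℕ} (D : SVDChoice τ n l m r) (k : V) :
    Matrix (Fin (m k)) (Fin (r k)) ℝ :=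
  D.V k * Matrix.diagonal fun i => (D.σ k i)⁻¹

/-- `A_k(β_{(k, C(k))}; α_{(k, C(k))})`, equal to `1` at a leaf. -/
def systemA {n l m r : V → ℕ} (s : ∀ k, Core τ n l k) (t : ∀ k, Core τ n m k) (p : Tensor n)
    (D : SVDChoice τ n l m r) (k : V) :
    Matrix (Joint l (τ.children k)) (Joint r (τ.children k)) ℝ :=
  Matrix.of fun β α => ∏ w : τ.children k, (sketchEdgeZ τ s t p w * D.Q w) (β w) (α w)

/-- `B_k(β_{(k, C(k))}, x_k; α_{(k, P(k))})`: this is `U_k`, and `Z_k` at the root. (With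
`m τ.root = 1` the sum over the dummy index at the root has exactly one term.) -/
def systemB {n l m r : V → ℕ} (s : ∀ k, Core τ n l k) (t : ∀ k, Core τ n m k) (p : Tensor n)
    (D : SVDChoice τ n l m r) (k : V) :
    Matrix (Joint l (τ.children k) × Fin (n k)) (Fin (r k)) ℝ :=
  if k = τ.root then Matrix.of fun i _ => ∑ c, sketchZ τ s t p k i c else D.U k

/-- `B_k` reshaped to `B_k(β_{(k, C(k))}; x_k, α_{(k, P(k))})`. -/
def systemB' {n l m r : V → ℕ} (s : ∀ k, Core τ n l k) (t : ∀ k, Core τ n m k) (p : Tensor n)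
    (D : SVDChoice τ n l m r) (k : V) :
    Matrix (Joint l (τ.children k)) (Fin (n k) × Fin (r k)) ℝ :=
  Matrix.of fun β i => systemB τ s t p D k (β, i.1) i.2

/-- The cores `G` are an output of TTNS-Sketch with input tensor `p`, recursive sketch functions
given by `s`, `t` and target ranks `r`, when `D` are the truncated singular value decompositions
used on the way. -/
structure IsSketchOutput {n l m r : V → ℕ} (s : ∀ k, Core τ n l k) (t : ∀ k, Core τ n m k)
    (p : Tensor n) (D : SVDChoice τ n l m r) (G : ∀ k, Core τ n r k) : Prop where
  svd : ∀ k, k ≠ τ.root → IsTruncatedSVD (sketchZ τ s t p k) (D.U k) (D.σ k) (D.V k)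
  leaf : ∀ k, τ.IsLeaf k → ∀ β x α a, G k x α a = systemB τ s t p D k (β, x) a
  nonleaf : ∀ k, ¬ τ.IsLeaf k →
    IsLeastSquares (systemA τ s t p D k) (systemB' τ s t p D k) (coreMatrix τ (G k))

/-! ### The constants -/

/-- `c_C`, the largest number of children. -/
def cC : ℕ := Finset.univ.sup fun k => (τ.children k).card

open Classical in
/-- `c_{k;Z}`. -/
def cZ {n l m : V → ℕ} (r : V → ℕ) (s : ∀ k, Core τ n l k) (t : ∀ k, Core τ n m k)
    (p : Tensor n) (k : V) : ℝ :=
  if k = τ.root then 1 else sigma (r k) (sketchZ τ s t p k)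

/-- `c_{k;G}`. -/
def cG {n r : V → ℕ} {k : V} (G : Core τ n r k) : ℝ := 1 / triNorm τ G

open Classical in
/-- `c_{k;A}`. -/
def cA {n l m r : V → ℕ} (s : ∀ k, Core τ n l k) (t : ∀ k, Core τ n m k) (p : Tensor n)
    (D : SVDChoice τ n l m r) (k : V) : ℝ :=
  if τ.IsLeaf k then 1 else ‖pinv (systemA τ s t p D k)‖

open Classical in
/-- `c_{k;S}`. -/
def cS {n l : V → ℕ} (s : ∀ k, Core τ n l k) (k : V) : ℝ :=
  if τ.IsLeaf k then 1 else ∏ w ∈ τ.children k, ‖sketchCoreMatrix τ (s w)‖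

/-- `ξ`. -/
def xi {n l m r : V → ℕ} (s : ∀ k, Core τ n l k) (t : ∀ k, Core τ n m k) (p : Tensor n)
    (D : SVDChoice τ n l m r) (G : ∀ k, Core τ n r k) : ℝ :=
  min 1 (⨅ i : V, (2 * cA τ s t p D i * (cS τ s i + cG τ (G i)))⁻¹)

/-- `ζ_k`. -/
def zeta {n l m r : V → ℕ} (s : ∀ k, Core τ n l k) (t : ∀ k, Core τ n m k) (p : Tensor n)
    (D : SVDChoice τ n l m r) (G : ∀ k, Core τ n r k) (k : V) : ℝ :=
  (6 * ((cC τ : ℝ) / cZ τ r s t p k))⁻¹ * xi τ s t p D G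

/-- `(⨂_{w ∈ C(k)} R_wᵀ) ∘ G ∘ R_k`: every bond index of the core at `k` is rotated. -/
def rotateCore {n r : V → ℕ} (R : ∀ k, Matrix (Fin (r k)) (Fin (r k)) ℝ) {k : V}
    (G : Core τ n r k) : Core τ n r k :=
  fun x α a => ∑ α' : Joint r (τ.children k), ∑ a' : Fin (r k),
    (∏ w : τ.children k, (R w)ᵀ (α w) (α' w)) * G x α' a' * R k a' a

end TTNS

end

/-! The proof combines exact recovery from p⋆ with a perturbation analysis carried out separately at
each vertex.

Recovery (`IsSketchOutput.recovery`). Write Φ̄_k for p⋆ sketched from the right only. Condition (i)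
and the rank of Z_k make Φ_k = Φ̄_k Q_k the left factors of a low-rank decomposition of p⋆. Left
inverses of the Φ_w then produce cores with Φ_k = (⨂_w Φ_w) G_k (`exists_core_recursion`). Applying
the left sketch to this recursion yields exactly A_k G_k = B_k (`gaugeA_mul_coreMatrix`). By (iii),
A_k has full column rank, so the cores of the algorithm are these cores. Unrolling the recursion
from the root, where Φ is p⋆, writes p⋆ as a TTNS. Replacing Φ_k by Φ_k R_k rotates the cores
without changing p⋆.

Perturbation. Since Z_{w→k} = s_w Z_w and Z_w Q_w = U_w, the system matrix is A_k = ⨂_w s_w U_w, so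
no error accumulates along the tree: only the U_w of the children matter. With e = ξδ/(6 c_C) the
hypothesis says ‖Z⋆_k - Ẑ_k‖ ≤ c_{k;Z} e. A Wedin-type bound, whose rotation is a polar factor,
gives ‖Û_w - U_w R_w‖ ≤ 2e (`IsTruncatedSVD.exists_orthogonal_opNorm_sub_le`). Exchanging the
Kronecker factors one by one gives ‖Â_k - A_k ⨂R_w‖ ≤ c_C c_{k;S} 2e = c_{k;S} ξδ/3
(`opNorm_systemA_sub_le`). The rotated core solves the rotated system exactly, so least-squares
perturbation on each slice (`opNorm_sub_le_of_normal_eq`) together with 2 c_A (c_S + c_G) ξ ≤ 1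
bounds the relative error of the core by δ/5. -/

set_option linter.unusedSectionVars false

/-! ### Spectral norms and quadratic forms of real matrices. -/

section LinearAlgebra

open Matrix

variable {m n q : Type*} [Fintype m] [Fintype n] [Fintype q]

theorem norm_toLp_sq (v : n → ℝ) : ‖WithLp.toLp 2 v‖ ^ 2 = v ⬝ᵥ v := by
  rw [EuclideanSpace.norm_sq_eq]; simp [dotProduct, sq]

theorem dotProduct_self_nonneg' (v : n → ℝ) : 0 ≤ v ⬝ᵥ v := by
  rw [← norm_toLp_sq]; positivity

theorem norm_toLp_mulVec_le [DecidableEq n] (M : Matrix m n ℝ) (v : n → ℝ) :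
    ‖WithLp.toLp 2 (M *ᵥ v)‖ ≤ ‖M‖ * ‖WithLp.toLp 2 v‖ :=
  Matrix.l2_opNorm_mulVec M (WithLp.toLp 2 v)

theorem opNorm_le_of_norm_mulVec_le [DecidableEq n] {M : Matrix m n ℝ} {c : ℝ} (hc : 0 ≤ c)
    (h : ∀ v : n → ℝ, ‖WithLp.toLp 2 (M *ᵥ v)‖ ≤ c * ‖WithLp.toLp 2 v‖) : ‖M‖ ≤ c := by
  rw [Matrix.l2_opNorm_def]
  refine ContinuousLinearMap.opNorm_le_bound _ hc fun v => ?_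
  exact h v.ofLp

theorem opNorm_le_of_dotProduct_le [DecidableEq n] {M : Matrix m n ℝ} {c : ℝ} (hc : 0 ≤ c)
    (h : ∀ v : n → ℝ, M *ᵥ v ⬝ᵥ M *ᵥ v ≤ c ^ 2 * (v ⬝ᵥ v)) : ‖M‖ ≤ c := by
  refine opNorm_le_of_norm_mulVec_le hc fun v => ?_
  refine le_of_sq_le_sq ?_ (by positivity)
  rw [mul_pow, norm_toLp_sq, norm_toLp_sq]; exact h v

theorem dotProduct_mulVec_le [DecidableEq n] (M : Matrix m n ℝ) (v : n → ℝ) :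
    M *ᵥ v ⬝ᵥ M *ᵥ v ≤ ‖M‖ ^ 2 * (v ⬝ᵥ v) := by
  rw [← norm_toLp_sq, ← norm_toLp_sq, ← mul_pow]
  gcongr; exact norm_toLp_mulVec_le M v

theorem mulVec_dotProduct_mulVec (M : Matrix m n ℝ) (N : Matrix m q ℝ) (v : n → ℝ) (w : q → ℝ) :
    M *ᵥ v ⬝ᵥ N *ᵥ w = v ⬝ᵥ (Mᵀ * N) *ᵥ w := by
  rw [← mulVec_mulVec, dotProduct_mulVec v Mᵀ, vecMul_transpose]

theorem opNorm_le_one_of_transpose_mul_self [DecidableEq n] {U : Matrix m n ℝ} (h : Uᵀ * U = 1) :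
    ‖U‖ ≤ 1 := by
  refine opNorm_le_of_dotProduct_le zero_le_one fun v => ?_
  rw [mulVec_dotProduct_mulVec, h]; simp

theorem opNorm_sub_projection_le_one [DecidableEq m] [DecidableEq n] {U : Matrix m n ℝ}
    (h : Uᵀ * U = 1) : ‖(1 : Matrix m m ℝ) - U * Uᵀ‖ ≤ 1 := by
  refine opNorm_le_of_dotProduct_le zero_le_one fun v => ?_
  have h1 : (1 - U * Uᵀ)ᵀ * (1 - U * Uᵀ) = 1 - U * Uᵀ := by
    have : U * Uᵀ * (U * Uᵀ) = U * Uᵀ := by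
      rw [Matrix.mul_assoc, ← Matrix.mul_assoc Uᵀ, h, Matrix.one_mul]
    simp [transpose_sub, transpose_mul, Matrix.mul_sub, Matrix.sub_mul, this]
  have h2 : v ⬝ᵥ (U * Uᵀ) *ᵥ v = Uᵀ *ᵥ v ⬝ᵥ Uᵀ *ᵥ v := by
    rw [mulVec_dotProduct_mulVec, transpose_transpose]
  rw [mulVec_dotProduct_mulVec, h1, sub_mulVec, dotProduct_sub, h2, one_mulVec]
  have := dotProduct_self_nonneg' (Uᵀ *ᵥ v)
  linarith

/-- Spectral theorem for real symmetric matrices. -/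
theorem exists_orthogonal_diagonal [DecidableEq n] {S : Matrix n n ℝ} (hS : Sᵀ = S) :
    ∃ (X : Matrix n n ℝ) (d : n → ℝ), Xᵀ * X = 1 ∧ X * Xᵀ = 1 ∧ S = X * diagonal d * Xᵀ := by
  have hH : S.IsHermitian := by
    rwa [Matrix.IsHermitian, Matrix.conjTranspose_eq_transpose_of_trivial]
  refine ⟨hH.eigenvectorUnitary, hH.eigenvalues, ?_, ?_, ?_⟩
  · have := Matrix.mem_unitaryGroup_iff'.1 hH.eigenvectorUnitary.2
    simpa [Matrix.star_eq_conjTranspose, Matrix.conjTranspose_eq_transpose_of_trivial] using this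
  · have := Matrix.mem_unitaryGroup_iff.1 hH.eigenvectorUnitary.2
    simpa [Matrix.star_eq_conjTranspose, Matrix.conjTranspose_eq_transpose_of_trivial] using this
  · have := hH.spectral_theorem
    simpa [Unitary.conjStarAlgAut_apply, Matrix.star_eq_conjTranspose,
      Matrix.conjTranspose_eq_transpose_of_trivial, Function.comp_def] using this

theorem dotProduct_conj_diagonal_le [DecidableEq n] {X : Matrix n n ℝ} {d : n → ℝ} {c : ℝ}
    (hX : X * Xᵀ = 1) (hd : ∀ i, d i ≤ c) (v : n → ℝ) :
    v ⬝ᵥ (X * diagonal d * Xᵀ) *ᵥ v ≤ c * (v ⬝ᵥ v) := by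
  have e1 : v ⬝ᵥ (X * diagonal d * Xᵀ) *ᵥ v = Xᵀ *ᵥ v ⬝ᵥ diagonal d *ᵥ (Xᵀ *ᵥ v) := by
    rw [mulVec_mulVec, mulVec_dotProduct_mulVec, transpose_transpose, Matrix.mul_assoc]
  have e2 : v ⬝ᵥ v = Xᵀ *ᵥ v ⬝ᵥ Xᵀ *ᵥ v := by
    rw [mulVec_dotProduct_mulVec, transpose_transpose, hX, one_mulVec]
  rw [e1, e2, dotProduct, dotProduct, Finset.mul_sum]
  refine Finset.sum_le_sum fun i _ => ?_
  rw [mulVec_diagonal]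
  nlinarith [hd i, mul_self_nonneg ((Xᵀ *ᵥ v) i)]

/-- The Rayleigh quotient at a unit eigenvector, which turns bounds on a quadratic form into bounds
on single eigenvalues. -/
theorem eigenvalue_eq_dotProduct [DecidableEq n] {X S : Matrix n n ℝ} {d : n → ℝ}
    (hX : Xᵀ * X = 1) (hS : S = X * diagonal d * Xᵀ) (j : n) :
    d j = (X *ᵥ Pi.single j 1) ⬝ᵥ S *ᵥ (X *ᵥ Pi.single j 1) := by
  have : Xᵀ * (S * X) = diagonal d := by
    rw [hS, Matrix.mul_assoc, hX, Matrix.mul_one, ← Matrix.mul_assoc, hX, Matrix.one_mul]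
  rw [mulVec_mulVec, mulVec_dotProduct_mulVec, this]
  simp

end LinearAlgebra

/-! ### Kronecker products of finite families. -/

section PiKronecker

open Matrix

variable {ι : Type*} [Fintype ι] [DecidableEq ι] {l r q : ι → Type*} [∀ i, Fintype (l i)]
  [∀ i, Fintype (r i)] [∀ i, Fintype (q i)]

/-- The Kronecker product of a finite family of matrices. -/
def piKronecker (M : ∀ i, Matrix (l i) (r i) ℝ) : Matrix (∀ i, l i) (∀ i, r i) ℝ :=
  Matrix.of fun β α => ∏ i, M i (β i) (α i)

theorem piKronecker_apply (M : ∀ i, Matrix (l i) (r i) ℝ) (β : ∀ i, l i) (α : ∀ i, r i) :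
    piKronecker M β α = ∏ i, M i (β i) (α i) := rfl

theorem piKronecker_mul (M : ∀ i, Matrix (l i) (r i) ℝ) (N : ∀ i, Matrix (r i) (q i) ℝ) :
    piKronecker M * piKronecker N = piKronecker fun i => M i * N i := by
  ext β α
  simp only [mul_apply, piKronecker_apply, ← Finset.prod_mul_distrib]
  rw [Finset.prod_univ_sum]; simp

theorem transpose_piKronecker (M : ∀ i, Matrix (l i) (r i) ℝ) :
    (piKronecker M)ᵀ = piKronecker fun i => (M i)ᵀ := rfl

theorem piKronecker_diagonal [∀ i, DecidableEq (r i)] (d : ∀ i, r i → ℝ) :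
    piKronecker (fun i => diagonal (d i)) = diagonal fun α => ∏ i, d i (α i) := by
  ext β α
  rw [piKronecker_apply, diagonal_apply]
  split_ifs with h
  · subst h; simp
  · obtain ⟨i, hi⟩ := Function.ne_iff.1 h
    exact Finset.prod_eq_zero (Finset.mem_univ i) (by simp [hi])

theorem piKronecker_one [∀ i, DecidableEq (r i)] :
    piKronecker (fun i => (1 : Matrix (r i) (r i) ℝ)) = 1 := by
  have := piKronecker_diagonal (r := r) fun _ _ => 1
  simpa using this

/-- Diagonalising each Gram matrix Mᵢᵀ Mᵢ diagonalises the Gram matrix of the product, with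
eigenvalues the products of the dᵢ. Since 0 ≤ dᵢ ≤ ‖Mᵢ‖², these are at most ∏ ‖Mᵢ‖². -/
theorem opNorm_piKronecker_le [∀ i, DecidableEq (r i)] (M : ∀ i, Matrix (l i) (r i) ℝ) :
    ‖piKronecker M‖ ≤ ∏ i, ‖M i‖ := by
  have hsymm : ∀ i, ((M i)ᵀ * M i)ᵀ = (M i)ᵀ * M i := fun i => by simp [transpose_mul]
  choose X d hX hX' hd using fun i => exists_orthogonal_diagonal (hsymm i)
  have hdj : ∀ i j, d i j = M i *ᵥ (X i *ᵥ Pi.single j 1) ⬝ᵥ M i *ᵥ (X i *ᵥ Pi.single j 1) := by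
    intro i j
    rw [eigenvalue_eq_dotProduct (hX i) (hd i) j, mulVec_dotProduct_mulVec (M i)]
  have hd0 : ∀ i j, 0 ≤ d i j := fun i j => by rw [hdj]; exact dotProduct_self_nonneg' _
  have hd1 : ∀ i j, d i j ≤ ‖M i‖ ^ 2 := fun i j => by
    rw [hdj]
    refine (dotProduct_mulVec_le _ _).trans_eq ?_
    rw [mulVec_dotProduct_mulVec, hX]; simp
  refine opNorm_le_of_dotProduct_le (Finset.prod_nonneg fun i _ => norm_nonneg _) fun v => ?_
  rw [mulVec_dotProduct_mulVec, transpose_piKronecker, piKronecker_mul, funext hd,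
    ← piKronecker_mul, ← piKronecker_mul, piKronecker_diagonal, ← transpose_piKronecker]
  refine dotProduct_conj_diagonal_le ?_ (fun α => ?_) v
  · rw [transpose_piKronecker, piKronecker_mul, funext hX', piKronecker_one]
  · rw [← Finset.prod_pow]
    exact Finset.prod_le_prod (fun i _ => hd0 i _) fun i _ => hd1 i _

/-- Telescoping: the factors N are replaced by M one index at a time. Each replacement changes the
product by a Kronecker product with M w - N w in one slot, of norm at most η ∏ c. -/
theorem opNorm_piKronecker_sub_le [∀ i, DecidableEq (r i)] {M N : ∀ i, Matrix (l i) (r i) ℝ}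
    {c : ι → ℝ} {η : ℝ} (hM : ∀ i, ‖M i‖ ≤ c i) (hN : ∀ i, ‖N i‖ ≤ c i)
    (hMN : ∀ i, ‖M i - N i‖ ≤ c i * η) :
    ‖piKronecker M - piKronecker N‖ ≤ Fintype.card ι * (η * ∏ i, c i) := by
  have key : ∀ W : Finset ι, ‖piKronecker (fun i => if i ∈ W then M i else N i) - piKronecker N‖ ≤
      W.card * (η * ∏ i, c i) := by
    intro W
    induction W using Finset.induction_on with
    | empty => simp
    | insert w W hw ih =>
      have e : piKronecker (fun i => if i ∈ insert w W then M i else N i) -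
          piKronecker (fun i => if i ∈ W then M i else N i) =
          piKronecker fun i => if i = w then M i - N i else if i ∈ W then M i else N i := by
        ext β α
        simp only [Matrix.sub_apply, piKronecker_apply]
        rw [← Finset.mul_prod_erase _ _ (Finset.mem_univ w),
          ← Finset.mul_prod_erase _ _ (Finset.mem_univ w),
          ← Finset.mul_prod_erase _ _ (Finset.mem_univ w)]
        simp only [Finset.mem_insert_self, if_true, hw, if_false, Matrix.sub_apply, sub_mul]
        congr 2
        · refine Finset.prod_congr rfl fun i hi => ?_
          simp [Finset.ne_of_mem_erase hi]
        · refine Finset.prod_congr rfl fun i hi => ?_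
          simp [Finset.ne_of_mem_erase hi]
      have e' : ‖piKronecker (fun i => if i ∈ insert w W then M i else N i) -
          piKronecker (fun i => if i ∈ W then M i else N i)‖ ≤ η * ∏ i, c i := by
        rw [e]
        refine (opNorm_piKronecker_le _).trans ?_
        rw [← Finset.mul_prod_erase _ _ (Finset.mem_univ w),
          ← Finset.mul_prod_erase _ c (Finset.mem_univ w), ← mul_assoc, mul_comm η]
        refine mul_le_mul (by simpa using hMN w) ?_
          (Finset.prod_nonneg fun i _ => norm_nonneg _) ((norm_nonneg _).trans (hMN w))
        refine Finset.prod_le_prod (fun i _ => norm_nonneg _) fun i hi => ?_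
        rw [if_neg (Finset.ne_of_mem_erase hi)]
        split_ifs
        exacts [hM i, hN i]
      rw [Finset.card_insert_of_notMem hw]
      refine (norm_sub_le_norm_sub_add_norm_sub _
        (piKronecker (fun i => if i ∈ W then M i else N i)) _).trans ?_
      push_cast
      linarith
  simpa using key Finset.univ

end PiKronecker

/-! ### Perturbation of singular values and singular subspaces. -/

section SingularSubspaces

open Matrix

variable {m n q : Type*} [Fintype m] [DecidableEq m] [Fintype n] [DecidableEq n] [Fintype q]

/-- If the columns of `W` are orthonormal and almost in the column space of `U`, then `W` is close
to `U * R` for an orthogonal matrix `R`. -/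
theorem exists_orthogonal_opNorm_sub_le {r : ℕ} {U W : Matrix m (Fin r) ℝ} (hU : Uᵀ * U = 1)
    (hW : Wᵀ * W = 1) {e : ℝ} (he0 : 0 ≤ e) (he1 : e < 1) (h : ‖W - U * (Uᵀ * W)‖ ≤ e) :
    ∃ R ∈ Matrix.orthogonalGroup (Fin r) ℝ, ‖W - U * R‖ ≤ 3 / 2 * e := by
  set M := Uᵀ * W with hM
  obtain ⟨X, d, hX, hX', hd⟩ := exists_orthogonal_diagonal (S := Mᵀ * M) (by simp [transpose_mul])
  have hWM : (W - U * M)ᵀ * (W - U * M) = 1 - Mᵀ * M := by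
    have e1 : Wᵀ * (U * M) = Mᵀ * M := by
      rw [← Matrix.mul_assoc, hM, transpose_mul, transpose_transpose]
    have e2 : (U * M)ᵀ * W = Mᵀ * M := by
      rw [transpose_mul, Matrix.mul_assoc, ← hM]
    have e3 : (U * M)ᵀ * (U * M) = Mᵀ * M := by
      rw [transpose_mul, Matrix.mul_assoc, ← Matrix.mul_assoc Uᵀ, hU, Matrix.one_mul]
    rw [transpose_sub, Matrix.sub_mul, Matrix.mul_sub, Matrix.mul_sub, hW, e1, e2, e3]
    simp
  have hdj : ∀ j, d j = M *ᵥ (X *ᵥ Pi.single j 1) ⬝ᵥ M *ᵥ (X *ᵥ Pi.single j 1) := fun j => by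
    rw [eigenvalue_eq_dotProduct hX hd j, mulVec_dotProduct_mulVec M]
  have hXj : ∀ j, X *ᵥ Pi.single j 1 ⬝ᵥ X *ᵥ Pi.single j 1 = 1 := fun j => by
    rw [mulVec_dotProduct_mulVec, hX]; simp
  -- On a unit eigenvector of MᵀM the residual has squared length 1 - d j, so 1 - e² ≤ d j ≤ 1. As e
  -- < 1, MᵀM is invertible.
  have h1d : ∀ j, 1 - d j =
      (W - U * M) *ᵥ (X *ᵥ Pi.single j 1) ⬝ᵥ (W - U * M) *ᵥ (X *ᵥ Pi.single j 1) := fun j => by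
    rw [mulVec_dotProduct_mulVec, hWM, sub_mulVec, dotProduct_sub, one_mulVec, hXj, hdj,
      mulVec_dotProduct_mulVec M]
  have hd1 : ∀ j, d j ≤ 1 := fun j => by
    have := dotProduct_self_nonneg' ((W - U * M) *ᵥ (X *ᵥ Pi.single j 1))
    rw [← h1d] at this; linarith
  have hde : ∀ j, 1 - d j ≤ e ^ 2 := fun j => by
    rw [h1d]
    refine (dotProduct_mulVec_le _ _).trans ?_
    rw [hXj, mul_one]; gcongr
  have hd0 : ∀ j, 0 < d j := fun j => by nlinarith [hde j]
  have hmul : ∀ a b : Fin r → ℝ, (X * diagonal a * Xᵀ) * (X * diagonal b * Xᵀ)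
      = X * diagonal (fun i => a i * b i) * Xᵀ := by
    intro a b
    calc _ = X * diagonal a * (Xᵀ * X) * diagonal b * Xᵀ := by
          simp only [Matrix.mul_assoc]
      _ = _ := by
          rw [hX, Matrix.mul_one, Matrix.mul_assoc X, Matrix.diagonal_mul_diagonal]
  have htr : ∀ a : Fin r → ℝ, (X * diagonal a * Xᵀ)ᵀ = X * diagonal a * Xᵀ := fun a => by
    simp [transpose_mul, Matrix.mul_assoc]
  -- K = (MᵀM)^(-1/2) and H = (MᵀM)^(1/2); the rotation is the orthogonal polar factor M K of M.
  set K := X * diagonal (fun i => (√(d i))⁻¹) * Xᵀ with hK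
  set H := X * diagonal (fun i => √(d i)) * Xᵀ with hH
  have hs : ∀ i, 0 < √(d i) := fun i => Real.sqrt_pos.2 (hd0 i)
  have hss : ∀ i, √(d i) * √(d i) = d i := fun i => Real.mul_self_sqrt (hd0 i).le
  have hMK : Mᵀ * (M * K) = H := by
    rw [← Matrix.mul_assoc, hd, hK, hmul, hH]
    congr 3; ext i
    rw [mul_inv_eq_iff_eq_mul₀ (hs i).ne', hss]
  have hKM : (M * K)ᵀ * M = H := by
    have := congrArg transpose hMK
    rwa [transpose_mul, transpose_transpose, hH, htr, ← hH] at this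
  have hRR : (M * K)ᵀ * (M * K) = 1 := by
    rw [← Matrix.mul_assoc, hKM, hH, hK, hmul]
    have : (fun i => √(d i) * (√(d i))⁻¹) = fun _ => 1 := by
      ext i; exact mul_inv_cancel₀ (hs i).ne'
    rw [this]; simp [hX']
  refine ⟨M * K, ?_, ?_⟩
  · rw [Matrix.mem_orthogonalGroup_iff']
    exact hRR
  · refine opNorm_le_of_dotProduct_le (by positivity) fun v => ?_
    -- The Gram matrix of the error is 2 - 2H. Its eigenvalues satisfy 2 - 2√d ≤ 2(1 - d) ≤ 2e², and
    -- 3/2 is a rational upper bound for √2.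
    have e0 : (W - U * (M * K))ᵀ * (W - U * (M * K)) =
        X * diagonal (fun i => 2 - 2 * √(d i)) * Xᵀ := by
      have e1 : Wᵀ * (U * (M * K)) = H := by
        rw [← hMK, ← Matrix.mul_assoc Wᵀ, hM, transpose_mul, transpose_transpose]
      have e2 : (U * (M * K))ᵀ * W = H := by
        rw [transpose_mul, Matrix.mul_assoc, ← hM, hKM]
      have e3 : (U * (M * K))ᵀ * (U * (M * K)) = 1 := by
        rw [transpose_mul, Matrix.mul_assoc, ← Matrix.mul_assoc Uᵀ, hU, Matrix.one_mul, hRR]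
      have e4 : diagonal (fun i => 2 - 2 * √(d i)) =
          (2 : ℝ) • (1 : Matrix (Fin r) (Fin r) ℝ) - (2 : ℝ) • diagonal fun i => √(d i) := by
        ext i j
        by_cases hij : i = j
        · subst hij; simp
        · simp [hij]
      rw [transpose_sub, Matrix.sub_mul, Matrix.mul_sub, Matrix.mul_sub, hW, e1, e2, e3, e4,
        Matrix.mul_sub, Matrix.sub_mul]
      simp only [Matrix.mul_smul, Matrix.smul_mul, Matrix.mul_one, hX', ← hH]
      module
    rw [mulVec_dotProduct_mulVec, e0]
    refine dotProduct_conj_diagonal_le hX' (fun i => ?_) v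
    have : √(d i) ≤ 1 := Real.sqrt_le_one.2 (hd1 i)
    nlinarith [hss i, hs i, hde i]

theorem opNorm_diagonal_le {r : ℕ} {d : Fin r → ℝ} {c : ℝ} (hc : 0 ≤ c) (h : ∀ i, |d i| ≤ c) :
    ‖(diagonal d : Matrix (Fin r) (Fin r) ℝ)‖ ≤ c := by
  rw [Matrix.l2_opNorm_diagonal]
  exact (pi_norm_le_iff_of_nonneg hc).2 h

theorem IsTruncatedSVD.mul_mul_diagonal_inv {m n : Type*} [Fintype m] [Fintype n] [DecidableEq n]
    {r : ℕ} {Z : Matrix m n ℝ} {U : Matrix m (Fin r) ℝ} {σ : Fin r → ℝ} {V : Matrix n (Fin r) ℝ}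
    (h : IsTruncatedSVD Z U σ V) (hσ : ∀ i, 0 < σ i) :
    Z * (V * Matrix.diagonal fun i => (σ i)⁻¹) = U := by
  rw [← Matrix.mul_assoc, h.mul_right, Matrix.mul_assoc, Matrix.diagonal_mul_diagonal]
  have : (fun i => σ i * (σ i)⁻¹) = fun _ => 1 := by
    ext i; exact mul_inv_cancel₀ (hσ i).ne'
  rw [this]; simp

/-- The left singular vectors of a perturbation of `Z` are close to the column space of `Z`. -/
theorem IsTruncatedSVD.opNorm_sub_projection_le {r : ℕ} {Z Z' : Matrix m n ℝ}
    {U U' : Matrix m (Fin r) ℝ} {σ : Fin r → ℝ} {V : Matrix n (Fin r) ℝ}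
    (h : IsTruncatedSVD Z' U' σ V) (hU : Uᵀ * U = 1) (hUZ : U * (Uᵀ * Z) = Z) {e g : ℝ}
    (hg : 0 < g) (hσ : ∀ i, g ≤ σ i) (he : ‖Z - Z'‖ ≤ e) :
    ‖U' - U * (Uᵀ * U')‖ ≤ e / g := by
  have he' : ‖Z' - Z‖ ≤ e := by rwa [norm_sub_rev]
  have he0 : 0 ≤ e := (norm_nonneg _).trans he
  -- U' = Z' V Σ⁻¹, and the projection 1 - U Uᵀ annihilates Z, so only Z' - Z contributes.
  have key : U' - U * (Uᵀ * U') =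
      (1 - U * Uᵀ) * (Z' - Z) * V * diagonal fun i => (σ i)⁻¹ := by
    have e1 : Z' * (V * diagonal fun i => (σ i)⁻¹) = U' :=
      h.mul_mul_diagonal_inv fun i => hg.trans_le (hσ i)
    have e2 : (1 - U * Uᵀ) * (Z' - Z) = (1 - U * Uᵀ) * Z' := by
      rw [Matrix.mul_sub, Matrix.sub_mul 1 _ Z, Matrix.mul_assoc U, hUZ]; simp
    rw [e2, Matrix.mul_assoc, Matrix.mul_assoc, e1, Matrix.sub_mul,
      Matrix.one_mul, Matrix.mul_assoc]
  rw [key]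
  calc _ ≤ ‖(1 - U * Uᵀ) * (Z' - Z) * V‖ * ‖diagonal fun i => (σ i)⁻¹‖ := l2_opNorm_mul _ _
    _ ≤ ‖(1 - U * Uᵀ) * (Z' - Z)‖ * ‖V‖ * ‖diagonal fun i => (σ i)⁻¹‖ := by
        gcongr; exact l2_opNorm_mul _ _
    _ ≤ ‖(1 - U * Uᵀ)‖ * ‖(Z' - Z)‖ * ‖V‖ * ‖diagonal fun i => (σ i)⁻¹‖ := by
        gcongr; exact l2_opNorm_mul _ _
    _ ≤ 1 * e * 1 * g⁻¹ := by
        gcongr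
        · exact opNorm_sub_projection_le_one hU
        · exact opNorm_le_one_of_transpose_mul_self h.orthonormal_right
        · refine opNorm_diagonal_le (by positivity) fun i => ?_
          have := hg.trans_le (hσ i)
          rw [abs_of_pos (by positivity)]
          exact inv_anti₀ hg (hσ i)
    _ = e / g := by ring

/-- On the span of `r` orthonormal vectors, `Z` does not contract by more than `σ_r(Z)`. -/
theorem exists_orthonormal_sigma_le (Z : Matrix m n ℝ) {r : ℕ} (hr : r ≤ Fintype.card n) :
    ∃ W : Matrix n (Fin r) ℝ, Wᵀ * W = 1 ∧
      ∀ c : Fin r → ℝ, sigma r Z ^ 2 * (c ⬝ᵥ c) ≤ Z *ᵥ (W *ᵥ c) ⬝ᵥ Z *ᵥ (W *ᵥ c) := by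
  set T := Matrix.toEuclideanLin Z with hT
  have hn : Module.finrank ℝ (EuclideanSpace ℝ n) = Fintype.card n := finrank_euclideanSpace
  set b := T.isSymmetric_adjoint_comp_self.eigenvectorBasis hn with hb
  set lam := T.isSymmetric_adjoint_comp_self.eigenvalues hn with hlam
  -- The columns are eigenvectors of the adjoint of T composed with T, for its r largest
  -- eigenvalues.
  set W : Matrix n (Fin r) ℝ := Matrix.of fun a j => b (Fin.castLE hr j) a with hW
  have hsum : ∀ c : Fin r → ℝ, WithLp.toLp 2 (W *ᵥ c) = ∑ j, c j • b (Fin.castLE hr j) := by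
    intro c
    ext a
    simp only [mulVec, dotProduct, hW, of_apply, WithLp.ofLp_sum, Finset.sum_apply,
      WithLp.ofLp_smul, Pi.smul_apply, smul_eq_mul]
    exact Finset.sum_congr rfl fun j _ => mul_comm _ _
  have hon : Orthonormal ℝ fun j : Fin r => b (Fin.castLE hr j) :=
    b.orthonormal.comp _ (Fin.castLE_injective hr)
  refine ⟨W, ?_, fun c => ?_⟩
  · ext i j
    have := orthonormal_iff_ite.1 hon i j
    rw [Matrix.one_apply, ← this]
    rw [PiLp.inner_apply, mul_apply]
    exact Finset.sum_congr rfl fun j _ => mul_comm _ _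
  · have hTv : Z *ᵥ (W *ᵥ c) ⬝ᵥ Z *ᵥ (W *ᵥ c) =
        inner ℝ (T (WithLp.toLp 2 (W *ᵥ c))) (T (WithLp.toLp 2 (W *ᵥ c))) := by
      rw [real_inner_self_eq_norm_sq, ← norm_toLp_sq]; rfl
    rw [hTv, ← LinearMap.adjoint_inner_right, ← LinearMap.comp_apply, hsum, map_sum]
    have hap : ∀ j : Fin r, (LinearMap.adjoint T ∘ₗ T) (c j • b (Fin.castLE hr j)) =
        (c j * lam (Fin.castLE hr j)) • b (Fin.castLE hr j) := fun j => by
      rw [map_smul, hb, LinearMap.IsSymmetric.apply_eigenvectorBasis, smul_smul]; rfl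
    simp only [hap]
    rw [hon.inner_sum, dotProduct, Finset.mul_sum]
    refine Finset.sum_le_sum fun j _ => ?_
    -- Library singular values are counted from 0, so `sigma r` has index r - 1, the last of the r
    -- indices in play.
    have hs : sigma r Z ^ 2 ≤ lam (Fin.castLE hr j) := by
      rw [hlam, ← T.sq_singularValues_fin hn]
      have := T.singularValues_antitone (show (j : ℕ) ≤ r - 1 by have := j.2; omega)
      have h0 := T.singularValues_nonneg (r - 1)
      rw [sigma, ← hT]
      simp only [Fin.val_castLE]
      gcongr
    simp only [conj_trivial]
    nlinarith [mul_self_nonneg (c j)]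

/-- The upper half of the min-max argument for Weyl's inequality. Split v into its part in the span
of V, which is a multiple of the i-th column, and a part w orthogonal to V. Their images under Z are
orthogonal because the remainder E satisfies UᵀE = 0, and ‖E‖ ≤ σ i controls the second one. -/
theorem IsTruncatedSVD.dotProduct_mulVec_le {r : ℕ} {Z : Matrix m n ℝ} {U : Matrix m (Fin r) ℝ}
    {σ : Fin r → ℝ} {V : Matrix n (Fin r) ℝ} (h : IsTruncatedSVD Z U σ V) (i : Fin r)
    {v : n → ℝ} (hv : ∀ j, j ≠ i → (Vᵀ *ᵥ v) j = 0) :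
    Z *ᵥ v ⬝ᵥ Z *ᵥ v ≤ σ i ^ 2 * (v ⬝ᵥ v) := by
  set D := diagonal σ
  set E := Z - U * D * Vᵀ with hE
  set a := Vᵀ *ᵥ v with ha
  set w := v - V *ᵥ a with hw
  have hVw : Vᵀ *ᵥ w = 0 := by
    rw [hw, mulVec_sub, mulVec_mulVec, h.orthonormal_right, one_mulVec, sub_self]
  have hUE : Uᵀ * E = 0 := by
    have h1 : Uᵀ * Z = D * Vᵀ := by
      have := congrArg transpose h.mul_left
      rwa [transpose_mul, transpose_mul, transpose_transpose, diagonal_transpose] at this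
    rw [hE, Matrix.mul_sub, h1, Matrix.mul_assoc U, ← Matrix.mul_assoc Uᵀ, h.orthonormal_left,
      Matrix.one_mul, sub_self]
  have hZv : Z *ᵥ v = U *ᵥ (D *ᵥ a) + E *ᵥ w := by
    have e1 : E *ᵥ w = Z *ᵥ w := by
      rw [hE, sub_mulVec, ← mulVec_mulVec, hVw]; simp
    have e2 : Z *ᵥ (V *ᵥ a) = U *ᵥ (D *ᵥ a) := by
      rw [mulVec_mulVec, h.mul_right, ← mulVec_mulVec]
    rw [e1, hw, mulVec_sub, e2]; abel
  have hort : U *ᵥ (D *ᵥ a) ⬝ᵥ E *ᵥ w = 0 := by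
    rw [mulVec_dotProduct_mulVec, hUE]; simp
  have hort' : E *ᵥ w ⬝ᵥ U *ᵥ (D *ᵥ a) = 0 := by rw [dotProduct_comm, hort]
  have hUD : U *ᵥ (D *ᵥ a) ⬝ᵥ U *ᵥ (D *ᵥ a) = σ i ^ 2 * (a ⬝ᵥ a) := by
    rw [mulVec_dotProduct_mulVec, h.orthonormal_left, one_mulVec, dotProduct, dotProduct,
      Finset.mul_sum]
    refine Finset.sum_congr rfl fun j _ => ?_
    rw [mulVec_diagonal]
    by_cases hj : j = i
    · subst hj; ring
    · rw [hv j hj]; ring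
  have hw2 : w ⬝ᵥ w = v ⬝ᵥ v - a ⬝ᵥ a := by
    have e1 : v ⬝ᵥ V *ᵥ a = a ⬝ᵥ a := by
      rw [dotProduct_mulVec, ← mulVec_transpose]
    have e2 : V *ᵥ a ⬝ᵥ V *ᵥ a = a ⬝ᵥ a := by
      rw [mulVec_dotProduct_mulVec, h.orthonormal_right, one_mulVec]
    have e3 : V *ᵥ a ⬝ᵥ v = a ⬝ᵥ a := by rw [dotProduct_comm, e1]
    rw [hw, dotProduct_sub, sub_dotProduct, sub_dotProduct, e1, e2, e3]
    ring
  have hEw : E *ᵥ w ⬝ᵥ E *ᵥ w ≤ σ i ^ 2 * (w ⬝ᵥ w) := by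
    refine (_root_.dotProduct_mulVec_le E w).trans ?_
    have := h.remainder_le i
    have h0 := dotProduct_self_nonneg' w
    gcongr
  rw [hZv, add_dotProduct, dotProduct_add, dotProduct_add, hort, hort', hUD]
  rw [hw2] at hEw
  linarith

/-- Weyl's inequality for the singular values kept by a truncated SVD. -/
theorem IsTruncatedSVD.sigma_le {r : ℕ} {Z Z' : Matrix m n ℝ} {U : Matrix m (Fin r) ℝ}
    {σ : Fin r → ℝ} {V : Matrix n (Fin r) ℝ} (h : IsTruncatedSVD Z' U σ V) (i : Fin r) :
    sigma r Z ≤ σ i + ‖Z - Z'‖ := by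
  have hr1 := i.2
  rcases le_or_gt r (Fintype.card n) with hr | hr
  · obtain ⟨W, hW, hc⟩ := exists_orthonormal_sigma_le Z hr
    -- These are r - 1 linear conditions on r coefficients, hence some nonzero vector in the span of
    -- W is orthogonal to every kept right singular vector except the i-th.
    let f : (Fin r → ℝ) →ₗ[ℝ] ({j : Fin r // j ≠ i} → ℝ) :=
      LinearMap.pi fun j => (LinearMap.proj j.1) ∘ₗ (Vᵀ * W).mulVecLin
    have hker : LinearMap.ker f ≠ ⊥ := by
      refine LinearMap.ker_ne_bot_of_finrank_lt ?_
      rw [Module.finrank_fintype_fun_eq_card, Module.finrank_fintype_fun_eq_card]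
      exact Fintype.card_subtype_lt (x := i) (by simp)
    obtain ⟨c, hcf, hc0⟩ := Submodule.exists_mem_ne_zero_of_ne_bot hker
    set v := W *ᵥ c with hv
    have hvc : v ⬝ᵥ v = c ⬝ᵥ c := by rw [hv, mulVec_dotProduct_mulVec, hW, one_mulVec]
    have hvj : ∀ j, j ≠ i → (Vᵀ *ᵥ v) j = 0 := fun j hj => by
      have := congrFun (LinearMap.mem_ker.1 hcf) ⟨j, hj⟩
      rw [hv, mulVec_mulVec]
      exact this
    have hpos : 0 < ‖WithLp.toLp 2 v‖ := by
      have : 0 < ‖WithLp.toLp 2 v‖ ^ 2 := by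
        rw [norm_toLp_sq, hvc]
        refine lt_of_le_of_ne (dotProduct_self_nonneg' c) fun h0 => hc0 ?_
        exact dotProduct_self_eq_zero.1 h0.symm
      exact (sq_pos_iff.1 this).symm.lt_of_le (norm_nonneg _)
    have hσ := h.nonneg i
    have h1 : sigma r Z * ‖WithLp.toLp 2 v‖ ≤ ‖WithLp.toLp 2 (Z *ᵥ v)‖ := by
      refine le_of_sq_le_sq ?_ (norm_nonneg _)
      rw [mul_pow, norm_toLp_sq, norm_toLp_sq, hvc]; exact hc c
    have h2 : ‖WithLp.toLp 2 (Z' *ᵥ v)‖ ≤ σ i * ‖WithLp.toLp 2 v‖ := by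
      refine le_of_sq_le_sq ?_ (by positivity)
      rw [mul_pow, norm_toLp_sq, norm_toLp_sq]; exact h.dotProduct_mulVec_le i hvj
    have h3 := norm_toLp_mulVec_le (Z - Z') v
    have h4 : WithLp.toLp 2 (Z *ᵥ v) = WithLp.toLp 2 (Z' *ᵥ v) +
        WithLp.toLp 2 ((Z - Z') *ᵥ v) := by
      rw [← WithLp.toLp_add, sub_mulVec]; simp
    have h5 := norm_add_le (WithLp.toLp 2 (Z' *ᵥ v)) (WithLp.toLp 2 ((Z - Z') *ᵥ v))
    rw [← h4] at h5
    refine le_of_mul_le_mul_right ?_ hpos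
    nlinarith
  · have : sigma r Z = 0 := by
      refine LinearMap.singularValues_of_finrank_le _ ?_
      rw [finrank_euclideanSpace]; omega
    rw [this]
    have := h.nonneg i
    positivity

theorem sigma_pos_of_rank {r : ℕ} (hr : 0 < r) {Z : Matrix m n ℝ} (h : Z.rank = r) :
    0 < sigma r Z := by
  rw [sigma, LinearMap.singularValues_pos_iff_lt_finrank_range]
  have : Module.finrank ℝ (LinearMap.range (toEuclideanLin Z)) = r := by
    rw [← h]
    exact (Matrix.rank_eq_finrank_range_toLin Z (PiLp.basisFun 2 ℝ m) (PiLp.basisFun 2 ℝ n)).symm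
  omega

theorem rank_of_transpose_mul_self {r : ℕ} {U : Matrix m (Fin r) ℝ} (h : Uᵀ * U = 1) :
    U.rank = r := by
  refine le_antisymm (by simpa using U.rank_le_card_width) ?_
  have := Matrix.rank_mul_le_right Uᵀ U
  rw [h] at this; simpa using this

/-- At rank exactly r the truncation loses nothing. If some σ i vanished, so would the remainder,
and Z would have rank below r. Hence U = Z V Σ⁻¹ has its columns in the range of Z, and equality of
dimensions makes U Uᵀ the projection onto that range. -/
theorem IsTruncatedSVD.of_rank_eq {r : ℕ} {Z : Matrix m n ℝ} {U : Matrix m (Fin r) ℝ}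
    {σ : Fin r → ℝ} {V : Matrix n (Fin r) ℝ} (h : IsTruncatedSVD Z U σ V) (hZ : Z.rank = r) :
    (∀ i, 0 < σ i) ∧ U * (Uᵀ * Z) = Z ∧ Z * (V * Vᵀ) = Z := by
  have hσ : ∀ i, 0 < σ i := by
    by_contra! hcon
    obtain ⟨i, hi⟩ := hcon
    have h0 : Z - U * diagonal σ * Vᵀ = 0 :=
      norm_le_zero_iff.1 ((h.remainder_le i).trans hi)
    have h1 : Z.rank ≤ (diagonal σ).rank := by
      rw [sub_eq_zero.1 h0]
      exact (Matrix.rank_mul_le_left _ _).trans (Matrix.rank_mul_le_right _ _)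
    rw [hZ, Matrix.rank_diagonal] at h1
    have h2 : Fintype.card {j // σ j ≠ 0} < r := by
      have := Fintype.card_subtype_lt (p := fun j => σ j ≠ 0) (x := i)
        (by simpa using le_antisymm hi (h.nonneg i))
      simpa using this
    omega
  have hU : U = Z * (V * diagonal fun i => (σ i)⁻¹) :=
    (h.mul_mul_diagonal_inv hσ).symm
  have hle : LinearMap.range U.mulVecLin ≤ LinearMap.range Z.mulVecLin := by
    nth_rw 1 [hU]
    rw [Matrix.mulVecLin_mul]; exact LinearMap.range_comp_le_range _ _
  have heq : LinearMap.range U.mulVecLin = LinearMap.range Z.mulVecLin := by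
    refine Submodule.eq_of_le_of_finrank_eq hle ?_
    change U.rank = Z.rank
    rw [hZ, rank_of_transpose_mul_self h.orthonormal_left]
  have hUZ : U * (Uᵀ * Z) = Z := by
    refine Matrix.ext_of_mulVec_single fun j => ?_
    have : Z *ᵥ Pi.single j 1 ∈ LinearMap.range U.mulVecLin := by
      rw [heq]; exact ⟨_, rfl⟩
    obtain ⟨c, hc⟩ := this
    rw [Matrix.mulVecLin_apply] at hc
    rw [← mulVec_mulVec, ← mulVec_mulVec, ← hc, mulVec_mulVec (M := Uᵀ), h.orthonormal_left,
      one_mulVec]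
  refine ⟨hσ, hUZ, ?_⟩
  have h1 : Uᵀ * Z = diagonal σ * Vᵀ := by
    have := congrArg transpose h.mul_left
    rwa [transpose_mul, transpose_mul, transpose_transpose, diagonal_transpose] at this
  rw [← Matrix.mul_assoc, h.mul_right, Matrix.mul_assoc, ← h1, hUZ]

/-- Singular subspace perturbation. -/
theorem IsTruncatedSVD.exists_orthogonal_opNorm_sub_le {r : ℕ} (hr : 0 < r) {Z Z' : Matrix m n ℝ}
    {U U' : Matrix m (Fin r) ℝ} {σ σ' : Fin r → ℝ} {V V' : Matrix n (Fin r) ℝ}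
    (h : IsTruncatedSVD Z U σ V) (h' : IsTruncatedSVD Z' U' σ' V') (hZ : Z.rank = r)
    {e : ℝ} (he : e ≤ 1 / 6) (hE : ‖Z - Z'‖ ≤ sigma r Z * e) :
    ∃ R ∈ Matrix.orthogonalGroup (Fin r) ℝ, ‖U' - U * R‖ ≤ 2 * e := by
  have hs := sigma_pos_of_rank hr hZ
  have he0 : 0 ≤ e := nonneg_of_mul_nonneg_right ((norm_nonneg _).trans hE) hs
  -- By Weyl, σ' i ≥ (1 - e) σ_r(Z) ≥ (5/6) σ_r(Z). The residual is then at most (6/5)e, and the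
  -- polar factor costs 3/2, for a total of (9/5)e ≤ 2e.
  have h1 := h'.opNorm_sub_projection_le h.orthonormal_left (h.of_rank_eq hZ).2.1
    (g := 5 / 6 * sigma r Z) (by positivity) (fun i => by
      have := h'.sigma_le (Z := Z) i
      nlinarith) hE
  have h2 : sigma r Z * e / (5 / 6 * sigma r Z) = 6 / 5 * e := by field_simp
  rw [h2] at h1
  obtain ⟨R, hR, hle⟩ := _root_.exists_orthogonal_opNorm_sub_le h.orthonormal_left
    h'.orthonormal_left (by positivity) (by linarith) h1
  exact ⟨R, hR, hle.trans (by linarith)⟩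

end SingularSubspaces

/-! ### Least-squares solutions and their stability. -/

section LeastSquares

open Matrix

variable {m n q : Type*} [Fintype m] [Fintype n] [Fintype q]

theorem sum_sum_mul_mul_apply (A : Matrix m n ℝ) (E : Matrix m q ℝ) (D : Matrix n q ℝ) :
    ∑ i, ∑ j, E i j * (A * D) i j = ∑ k, ∑ j, (Aᵀ * E) k j * D k j := by
  simp only [mul_apply, Finset.mul_sum, Finset.sum_mul, transpose_apply]
  rw [Finset.sum_comm]
  conv_lhs => enter [2, j]; rw [Finset.sum_comm]
  conv_rhs => rw [Finset.sum_comm]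
  refine Finset.sum_congr rfl fun _ _ => Finset.sum_congr rfl fun _ _ =>
    Finset.sum_congr rfl fun _ _ => ?_
  ring

/-- The normal equations. -/
theorem IsLeastSquares.normal_eq {A : Matrix m n ℝ} {B : Matrix m q ℝ} {X : Matrix n q ℝ}
    (h : IsLeastSquares A B X) : Aᵀ * (A * X - B) = 0 := by
  set E := A * X - B with hE
  set D := Aᵀ * E with hD
  set a := ∑ k, ∑ j, D k j * D k j with ha
  set b := ∑ i, ∑ j, (A * D) i j ^ 2 with hb
  -- Minimality of X is tested against a gradient step X - tD.
  have key : ∀ t : ℝ, 0 ≤ -2 * t * a + t ^ 2 * b := by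
    intro t
    have h1 := h (X - t • D)
    have h2 : A * (X - t • D) - B = E - t • (A * D) := by
      rw [Matrix.mul_sub, Matrix.mul_smul, hE]; abel
    rw [h2, ← hE] at h1
    have h3 : ∑ i, ∑ j, (E - t • (A * D)) i j ^ 2 =
        ∑ i, ∑ j, E i j ^ 2 - 2 * t * (∑ i, ∑ j, E i j * (A * D) i j) + t ^ 2 * b := by
      simp only [hb, Finset.mul_sum, ← Finset.sum_sub_distrib, ← Finset.sum_add_distrib,
        Matrix.sub_apply, Matrix.smul_apply, smul_eq_mul]
      refine Finset.sum_congr rfl fun _ _ => Finset.sum_congr rfl fun _ _ => ?_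
      ring
    rw [h3, sum_sum_mul_mul_apply, ← hD] at h1
    linarith
  have hb0 : 0 ≤ b := Finset.sum_nonneg fun _ _ => Finset.sum_nonneg fun _ _ => sq_nonneg _
  have ha0 : a = 0 := by
    have ha0 : 0 ≤ a := Finset.sum_nonneg fun _ _ => Finset.sum_nonneg fun _ _ => mul_self_nonneg _
    -- Near the optimal step a/b; the added 1 allows b = 0.
    have := key (a / (b + 1))
    have hb1 : 0 < b + 1 := by positivity
    have e : -2 * (a / (b + 1)) * a + (a / (b + 1)) ^ 2 * b =
        -(a ^ 2 * (b + 2)) / (b + 1) ^ 2 := by field_simp; ring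
    rw [e, neg_div, neg_nonneg] at this
    by_contra hne
    have : 0 < a ^ 2 * (b + 2) / (b + 1) ^ 2 := by positivity
    linarith
  ext k j
  have h1 := (Finset.sum_eq_zero_iff_of_nonneg fun k _ =>
    Finset.sum_nonneg fun j _ => mul_self_nonneg (D k j)).1 ha0 k (Finset.mem_univ _)
  have h2 := (Finset.sum_eq_zero_iff_of_nonneg fun j _ => mul_self_nonneg (D k j)).1 h1 j
    (Finset.mem_univ _)
  simpa using h2

theorem pinv_mul_self_of_rank [DecidableEq n] {A : Matrix m n ℝ}
    (hA : A.rank = Fintype.card n) : pinv A * A = 1 := by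
  have hinj : Function.Injective A.mulVec := by
    rw [Matrix.mulVec_injective_iff, linearIndependent_iff_card_eq_finrank_span, ← hA,
      Matrix.rank_eq_finrank_span_cols]; rfl
  refine Matrix.ext_of_mulVec_single fun j => hinj ?_
  rw [one_mulVec, mulVec_mulVec, ← Matrix.mul_assoc, (pinv_isMoorePenrose A).mul_mul_left]

/-- Perturbation of the solution of a linear system, to a least-squares solution. -/
theorem opNorm_sub_le_of_normal_eq [DecidableEq n] [DecidableEq q]
    {A A' : Matrix m n ℝ} {B B' : Matrix m q ℝ} {X X' : Matrix n q ℝ} {c e : ℝ}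
    (hc : 0 ≤ c) (hA : ∀ v : n → ℝ, ‖WithLp.toLp 2 v‖ ≤ c * ‖WithLp.toLp 2 (A *ᵥ v)‖)
    (he : ‖A' - A‖ ≤ e) (hce : c * e ≤ 1 / 6) (hAX : A * X = B) (hX' : A'ᵀ * (A' * X' - B') = 0) :
    ‖X' - X‖ ≤ 6 / 5 * c * (‖B' - B‖ + e * ‖X‖) := by
  have he0 : 0 ≤ e := (norm_nonneg _).trans he
  refine opNorm_le_of_norm_mulVec_le (by positivity) fun v => ?_
  set w := (X' - X) *ᵥ v with hw
  set F := B' - A' * X with hF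
  have hF' : F = (B' - B) - (A' - A) * X := by
    rw [hF, Matrix.sub_mul, hAX]; abel
  have hFn : ‖F‖ ≤ ‖B' - B‖ + e * ‖X‖ := by
    rw [hF']
    refine (norm_sub_le _ _).trans (add_le_add_right ?_ _)
    refine (l2_opNorm_mul _ _).trans ?_
    gcongr
  have hne : A'ᵀ * (A' * (X' - X)) = A'ᵀ * F := by
    rw [hF, Matrix.mul_sub A', Matrix.mul_sub, Matrix.mul_sub]
    rw [Matrix.mul_sub, sub_eq_zero] at hX'
    rw [hX']
  -- By `hne`, X' - X is a least-squares solution for the right side F, so A'(X' - X) is an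
  -- orthogonal projection of F.
  have h1 : ‖WithLp.toLp 2 (A' *ᵥ w)‖ ≤ ‖WithLp.toLp 2 (F *ᵥ v)‖ := by
    have e1 : A' *ᵥ w ⬝ᵥ A' *ᵥ w = A' *ᵥ w ⬝ᵥ F *ᵥ v := by
      rw [mulVec_dotProduct_mulVec, mulVec_dotProduct_mulVec A' F, ← hne, hw]
      simp only [mulVec_mulVec, Matrix.mul_assoc]
    have e2 : 0 ≤ (A' *ᵥ w - F *ᵥ v) ⬝ᵥ (A' *ᵥ w - F *ᵥ v) := dotProduct_self_nonneg' _
    rw [dotProduct_sub, sub_dotProduct, sub_dotProduct, dotProduct_comm (F *ᵥ v) (A' *ᵥ w),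
      ← e1] at e2
    refine le_of_sq_le_sq ?_ (norm_nonneg _)
    rw [norm_toLp_sq, norm_toLp_sq]; linarith
  have h2 : ‖WithLp.toLp 2 (A *ᵥ w)‖ ≤ ‖WithLp.toLp 2 (A' *ᵥ w)‖ + e * ‖WithLp.toLp 2 w‖ := by
    have e1 : WithLp.toLp 2 (A *ᵥ w) = WithLp.toLp 2 (A' *ᵥ w) -
        WithLp.toLp 2 ((A' - A) *ᵥ w) := by
      rw [← WithLp.toLp_sub, sub_mulVec]; simp
    rw [e1]
    refine (norm_sub_le _ _).trans (add_le_add_right ?_ _)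
    refine (norm_toLp_mulVec_le _ _).trans ?_
    gcongr
  have h3 := hA w
  have h4 := norm_toLp_mulVec_le F v
  have h5 : ‖F‖ * ‖WithLp.toLp 2 v‖ ≤ (‖B' - B‖ + e * ‖X‖) * ‖WithLp.toLp 2 v‖ := by gcongr
  have h6 : ‖WithLp.toLp 2 (A *ᵥ w)‖ ≤
      (‖B' - B‖ + e * ‖X‖) * ‖WithLp.toLp 2 v‖ + e * ‖WithLp.toLp 2 w‖ := by linarith
  have h7 := mul_le_mul_of_nonneg_left h6 hc
  have h8 := mul_le_mul_of_nonneg_right hce (norm_nonneg (WithLp.toLp 2 w))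
  -- The term c e ‖w‖ ≤ ‖w‖/6 is absorbed on the left, which produces the factor 6/5.
  nlinarith

end LeastSquares

/-! ### Partial sums over the coordinates of a joint index. -/

noncomputable section

section SumOut

variable {V : Type*} [Fintype V] [DecidableEq V] {X : V → Type*} [∀ v, Fintype (X v)]
  [∀ v, DecidableEq (X v)]

/-- Sum of `F` over the coordinates in `S`, the others being fixed. -/
def sumOut (S : Finset V) (F : (∀ v, X v) → ℝ) (x : ∀ v, X v) : ℝ :=
  ∑ z with ∀ v, v ∉ S → z v = x v, F z

theorem sumOut_congr {S : Finset V} {F F' : (∀ v, X v) → ℝ} {x : ∀ v, X v}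
    (h : ∀ z, (∀ v, v ∉ S → z v = x v) → F z = F' z) : sumOut S F x = sumOut S F' x :=
  Finset.sum_congr rfl fun z hz => h z (by simpa using hz)

theorem sumOut_union {S T : Finset V} (hST : Disjoint S T) (F : (∀ v, X v) → ℝ) (x : ∀ v, X v) :
    sumOut (S ∪ T) F x = sumOut S (sumOut T F) x := by
  unfold sumOut
  rw [Finset.sum_sigma']
  -- The intermediate point agrees with z on S and with x elsewhere.
  refine Finset.sum_nbij' (fun z => ⟨fun v => if v ∈ S then z v else x v, z⟩) (fun p => p.2)
    ?_ ?_ ?_ ?_ ?_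
  · intro z hz
    simp only [Finset.mem_sigma, Finset.mem_filter, Finset.mem_univ, true_and, Finset.mem_union,
      not_or] at hz ⊢
    refine ⟨fun v hv => if_neg hv, fun v hv => ?_⟩
    split_ifs with h
    exacts [rfl, hz v ⟨h, hv⟩]
  · intro p hp
    simp only [Finset.mem_sigma, Finset.mem_filter, Finset.mem_univ, true_and, Finset.mem_union,
      not_or] at hp ⊢
    exact fun v hv => (hp.2 v hv.2).trans (hp.1 v hv.1)
  · intro z _; rfl
  · rintro ⟨y, z⟩ hp
    simp only [Finset.mem_sigma, Finset.mem_filter, Finset.mem_univ, true_and] at hp ⊢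
    congr 1
    funext v
    split_ifs with h
    · exact hp.2 v (Finset.disjoint_left.1 hST h)
    · exact (hp.1 v h).symm
  · intro z _; rfl

theorem sumOut_mul_left {S : Finset V} {G F : (∀ v, X v) → ℝ} {x : ∀ v, X v} {c : ℝ}
    (h : ∀ z, (∀ v, v ∉ S → z v = x v) → G z = c) :
    sumOut S (fun z => G z * F z) x = c * sumOut S F x := by
  rw [sumOut, sumOut, Finset.mul_sum]
  exact Finset.sum_congr rfl fun z hz => by rw [h z (by simpa using hz)]

theorem sumOut_eq_of_dependsOn {S D : Finset V} {F : (∀ v, X v) → ℝ}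
    (hF : ∀ z z', (∀ v ∈ D, z v = z' v) → F z = F z') {x x' : ∀ v, X v}
    (h : ∀ v ∈ D, v ∉ S → x v = x' v) : sumOut S F x = sumOut S F x' := by
  refine Finset.sum_nbij' (fun z v => if v ∈ S then z v else x' v)
    (fun z v => if v ∈ S then z v else x v) ?_ ?_ ?_ ?_ ?_
  · intro z _; simp +contextual
  · intro z _; simp +contextual
  · intro z hz
    simp only [Finset.mem_filter, Finset.mem_univ, true_and] at hz
    funext v; by_cases hv : v ∈ S <;> simp [hv, hz]
  · intro z hz
    simp only [Finset.mem_filter, Finset.mem_univ, true_and] at hz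
    funext v; by_cases hv : v ∈ S <;> simp [hv, hz]
  · intro z hz
    simp only [Finset.mem_filter, Finset.mem_univ, true_and] at hz
    refine hF _ _ fun v hv => ?_
    split_ifs with hS
    · rfl
    · rw [hz v hS, h v hv hS]

theorem sumOut_empty (F : (∀ v, X v) → ℝ) (x : ∀ v, X v) : sumOut ∅ F x = F x := by
  have : (Finset.univ.filter fun z : ∀ v, X v => ∀ v, v ∉ (∅ : Finset V) → z v = x v) = {x} := by
    ext z; simp [funext_iff]
  rw [sumOut, this, Finset.sum_singleton]

/-- Distributivity: no summation set S i meets the variables D j of another factor. D i may exceed S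
i, the excess variables being parameters. This serves both for bond sums (S the descendants, D the
subtree) and for physical sums (both the subtree). -/
theorem sumOut_prod {ι : Type*} [DecidableEq ι] (W : Finset ι) (S D : ι → Finset V)
    (f : ι → (∀ v, X v) → ℝ)
    (hf : ∀ i ∈ W, ∀ z z', (∀ v ∈ D i, z v = z' v) → f i z = f i z')
    (hSD : ∀ i ∈ W, ∀ j ∈ W, i ≠ j → Disjoint (S i) (D j))
    (hSS : ∀ i ∈ W, ∀ j ∈ W, i ≠ j → Disjoint (S i) (S j)) (x : ∀ v, X v) :
    sumOut (W.biUnion S) (fun z => ∏ i ∈ W, f i z) x = ∏ i ∈ W, sumOut (S i) (f i) x := by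
  induction W using Finset.induction_on generalizing x with
  | empty => simp [sumOut_empty]
  | insert a W ha ih =>
    have ih' := ih (fun i hi => hf i (Finset.mem_insert_of_mem hi))
      (fun i hi j hj => hSD i (Finset.mem_insert_of_mem hi) j (Finset.mem_insert_of_mem hj))
      (fun i hi j hj => hSS i (Finset.mem_insert_of_mem hi) j (Finset.mem_insert_of_mem hj))
    have hne : ∀ i ∈ W, i ≠ a := fun i hi h => ha (h ▸ hi)
    have hd : Disjoint (S a) (W.biUnion S) := by
      rw [Finset.disjoint_biUnion_right]
      exact fun i hi => hSS a (Finset.mem_insert_self _ _) i (Finset.mem_insert_of_mem hi)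
        (hne i hi).symm
    rw [Finset.biUnion_insert, sumOut_union hd, Finset.prod_insert ha]
    have h1 : ∀ y, sumOut (W.biUnion S) (fun z => ∏ i ∈ insert a W, f i z) y =
        f a y * ∏ i ∈ W, sumOut (S i) (f i) y := by
      intro y
      simp only [Finset.prod_insert ha]
      rw [← ih' y]
      refine sumOut_mul_left fun z hz => hf a (Finset.mem_insert_self _ _) _ _ fun v hv => ?_
      refine hz v fun hv' => ?_
      obtain ⟨i, hi, hvi⟩ := Finset.mem_biUnion.1 hv'
      exact Finset.disjoint_left.1 (hSD i (Finset.mem_insert_of_mem hi) a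
        (Finset.mem_insert_self _ _) (hne i hi)) hvi hv
    have h2 : sumOut (S a) (sumOut (W.biUnion S) fun z => ∏ i ∈ insert a W, f i z) x =
        sumOut (S a) (fun y => (∏ i ∈ W, sumOut (S i) (f i) x) * f a y) x := by
      refine sumOut_congr fun y hy => ?_
      rw [h1, mul_comm]
      congr 1
      refine Finset.prod_congr rfl fun i hi => ?_
      refine sumOut_eq_of_dependsOn (hf i (Finset.mem_insert_of_mem hi)) fun v hv _ => ?_
      refine hy v fun hva => ?_
      exact Finset.disjoint_left.1 (hSD a (Finset.mem_insert_self _ _) i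
        (Finset.mem_insert_of_mem hi) (hne i hi).symm) hva hv
    rw [h2, sumOut_mul_left (G := fun _ => _) fun _ _ => rfl, mul_comm]

theorem sumOut_eq_sum_updateFinset (S : Finset V) (F : (∀ v, X v) → ℝ) (x : ∀ v, X v) :
    sumOut S F x = ∑ y : ∀ v : S, X v, F (Function.updateFinset x S y) := by
  refine Finset.sum_nbij' (fun z v => z v) (fun y => Function.updateFinset x S y) ?_ ?_ ?_ ?_ ?_
  · intro z _; exact Finset.mem_univ _
  · intro y _
    simp +contextual [Function.updateFinset]
  · intro z hz
    simp only [Finset.mem_filter, Finset.mem_univ, true_and] at hz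
    funext v
    by_cases hv : v ∈ S <;> simp [Function.updateFinset, hv, hz]
  · intro y _
    funext v; simp [Function.updateFinset]
  · intro z hz
    simp only [Finset.mem_filter, Finset.mem_univ, true_and] at hz
    congr 1
    funext v
    by_cases hv : v ∈ S <;> simp [Function.updateFinset, hv, hz]

theorem sumOut_restrict (S : Finset V) (f : (∀ v : S, X v) → ℝ) (x : ∀ v, X v) :
    sumOut S (fun z => f fun v => z v) x = ∑ y, f y := by
  rw [sumOut_eq_sum_updateFinset]
  refine Finset.sum_congr rfl fun y _ => ?_
  congr 1
  funext v; simp [Function.updateFinset]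

end SumOut

/-! ### Combinatorics of the rooted tree. -/

namespace TTNSTree

variable {V : Type*} [Fintype V] [DecidableEq V] (τ : TTNSTree V)

/-- The distance to the root. -/
def depth (v : V) : ℕ := (τ.isTree.existsUnique_path v τ.root).choose.length

theorem depth_parent {v : V} (hv : v ≠ τ.root) : τ.depth (τ.parent v) + 1 = τ.depth v := by
  obtain ⟨hp, -⟩ := (τ.isTree.existsUnique_path v τ.root).choose_spec
  have hq := (τ.isTree.existsUnique_path (τ.parent v) τ.root).choose_spec.2
  set p := (τ.isTree.existsUnique_path v τ.root).choose with hpdef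
  have hnil : ¬ p.Nil := SimpleGraph.Walk.not_nil_of_ne hv
  -- The tail of the path from v to the root is a path from the parent, hence the unique one.
  have h1 : p.tail = (τ.isTree.existsUnique_path (τ.parent v) τ.root).choose :=
    hq p.tail hp.tail
  have h2 := SimpleGraph.Walk.length_tail_add_one hnil
  rw [depth, depth, ← hpdef, ← h2, h1]
  rfl

theorem depth_child {w k : V} (h : w ∈ τ.children k) : τ.depth w = τ.depth k + 1 := by
  obtain ⟨h1, rfl⟩ := τ.mem_children.1 h
  exact (τ.depth_parent h1).symm

theorem depth_lt_of_mem_left {v k : V} (h : v ∈ τ.left k) : τ.depth k < τ.depth v := by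
  rw [mem_left] at h
  induction h with
  | single h => rw [τ.depth_child h]; omega
  | tail _ h ih => rw [τ.depth_child h] at ih; omega

theorem notMem_left_self (k : V) : k ∉ τ.left k := fun h => (τ.depth_lt_of_mem_left h).false

theorem mem_subtree {v k : V} : v ∈ τ.subtree k ↔ v = k ∨ v ∈ τ.left k := Finset.mem_insert

theorem mem_subtree_iff_reflTransGen {v k : V} :
    v ∈ τ.subtree k ↔ Relation.ReflTransGen (fun a b => a ∈ τ.children b) v k := by
  rw [mem_subtree, mem_left, Relation.reflTransGen_iff_eq_or_transGen, eq_comm]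

theorem left_eq_biUnion (k : V) : τ.left k = (τ.children k).biUnion τ.subtree := by
  ext v
  simp only [Finset.mem_biUnion, mem_subtree_iff_reflTransGen, mem_left,
    Relation.TransGen.tail'_iff]
  exact exists_congr fun _ => and_comm

theorem subtree_subset_left {w k : V} (h : w ∈ τ.children k) : τ.subtree w ⊆ τ.left k := by
  rw [left_eq_biUnion]; exact Finset.subset_biUnion_of_mem τ.subtree h

theorem children_subset_left (k : V) : τ.children k ⊆ τ.left k := fun _ h =>
  τ.subtree_subset_left h (τ.mem_subtree_self _)

theorem child_mem_left {v w k : V} (hv : v ∈ τ.subtree k) (hw : w ∈ τ.children v) :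
    w ∈ τ.left k := by
  rw [mem_subtree_iff_reflTransGen] at hv
  rw [mem_left]
  exact .head' hw hv

/-- Parents are unique, so two ancestors of one vertex are comparable, whereas distinct siblings
have equal depth and are not. -/
theorem disjoint_subtree {w w' k : V} (hw : w ∈ τ.children k) (hw' : w' ∈ τ.children k)
    (hne : w ≠ w') : Disjoint (τ.subtree w) (τ.subtree w') := by
  rw [Finset.disjoint_left]
  intro v h h'
  rw [mem_subtree_iff_reflTransGen] at h h'
  have hu : Relator.RightUnique fun a b => a ∈ τ.children b := fun a b c hb hc => by
    rw [← (τ.mem_children.1 hb).2, ← (τ.mem_children.1 hc).2]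
  have hd : τ.depth w = τ.depth w' := by rw [τ.depth_child hw, τ.depth_child hw']
  rcases Relation.ReflTransGen.total_of_right_unique hu h h' with h | h <;>
  · rw [← mem_subtree_iff_reflTransGen, mem_subtree] at h
    rcases h with h | h
    · first | exact hne h | exact hne h.symm
    · have := τ.depth_lt_of_mem_left h
      omega

theorem subtree_root : τ.subtree τ.root = Finset.univ := by
  refine Finset.eq_univ_of_forall fun v => ?_
  induction h : τ.depth v generalizing v with
  | zero =>
    rcases eq_or_ne v τ.root with rfl | hv
    · exact τ.mem_subtree_self _
    · have := τ.depth_parent hv; omega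
  | succ d ih =>
    rcases eq_or_ne v τ.root with rfl | hv
    · exact τ.mem_subtree_self _
    · have := ih (τ.parent v) (by have := τ.depth_parent hv; omega)
      exact τ.left_subset_subtree _ (τ.child_mem_left this (τ.mem_children.2 ⟨hv, rfl⟩))

theorem not_isLeaf_root [Nontrivial V] : ¬ τ.IsLeaf τ.root := by
  intro h
  obtain ⟨v, hv⟩ := exists_ne τ.root
  have h1 : v ∈ τ.subtree τ.root := by rw [subtree_root]; exact Finset.mem_univ v
  rw [mem_subtree, left_eq_biUnion, show τ.children τ.root = ∅ from h] at h1
  simp [hv] at h1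

theorem child_ne_root {w k : V} (h : w ∈ τ.children k) : w ≠ τ.root := (τ.mem_children.1 h).1

theorem mem_right {v k : V} : v ∈ τ.right k ↔ v ≠ k ∧ v ∉ τ.left k := by
  simp [right, mem_subtree]

theorem disjoint_left_right (k : V) : Disjoint (τ.left k) (τ.right k) := by
  rw [Finset.disjoint_left]
  intro v hv h
  exact (τ.mem_right.1 h).2 hv

theorem right_union_left (k : V) : τ.right k ∪ τ.left k = Finset.univ.erase k := by
  ext v
  simp only [Finset.mem_union, mem_right, Finset.mem_erase, Finset.mem_univ, and_true]
  have : v ∈ τ.left k → v ≠ k := by rintro h rfl; exact τ.notMem_left_self _ h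
  tauto

theorem mem_boundary_left {e k : V} : e ∈ τ.boundary (τ.left k) ↔ e ∈ τ.children k := by
  refine ⟨fun h => τ.boundary_left_subset k h, fun h => ?_⟩
  have h1 := τ.children_subset_left k h
  obtain ⟨h0, rfl⟩ := τ.mem_children.1 h
  have h2 := τ.notMem_left_self (τ.parent e)
  simp only [boundary, Finset.mem_filter, Finset.mem_univ, true_and]
  tauto

theorem incident_left_subset (k : V) : τ.incident (τ.left k) ⊆ τ.left k := by
  intro v hv
  rcases Finset.mem_union.1 hv with h | h
  · exact h
  · obtain ⟨u, hu, hv⟩ := Finset.mem_biUnion.1 h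
    exact τ.child_mem_left (τ.left_subset_subtree _ hu) hv

/-- Induction from the leaves to the root. -/
theorem induction_children {P : V → Prop} (h : ∀ k, (∀ w ∈ τ.children k, P w) → P k) (k : V) :
    P k := by
  induction hc : (τ.left k).card using Nat.strong_induction_on generalizing k with
  | _ c ih =>
    refine h k fun w hw => ih _ ?_ w rfl
    rw [← hc]
    refine Finset.card_lt_card ⟨(τ.left_subset_subtree w).trans (τ.subtree_subset_left hw), ?_⟩
    intro hsub
    exact τ.notMem_left_self w (hsub (τ.children_subset_left k hw))

end TTNSTree

end

/-! ### Contracting cores from the leaves upwards. -/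

noncomputable section

section Contraction

variable {V : Type*} [Fintype V] [DecidableEq V] (τ : TTNSTree V)

/-- The product of the cores at the vertices in `S`, at given physical and bond indices. -/
def coreProduct {n l : V → ℕ} (s : ∀ k, Core τ n l k) (S : Finset V) (x : ∀ v, Fin (n v))
    (β : ∀ v, Fin (l v)) : ℝ :=
  ∏ v ∈ S, s v (x v) (res (τ.children v) β) (β v)

theorem exists_res_eq {r : V → ℕ} (hr : ∀ v, 0 < r v) {S : Finset V} (α : Joint r S) :
    ∃ α' : ∀ v, Fin (r v), res S α' = α :=
  ⟨fun v => if h : v ∈ S then α ⟨v, h⟩ else ⟨0, hr v⟩, by funext v; simp [res]⟩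

/-- With bonds labelled by child ends, those touching L(k) are L(k) itself and those crossing its
boundary are C(k), so the contracted bonds are L(k) \ C(k). Working with full bond indices avoids
dependent index sets. -/
theorem leftSketch_eq_sumOut {n l : V → ℕ} (s : ∀ k, Core τ n l k) (k : V)
    (x : ∀ v, Fin (n v)) (β : ∀ v, Fin (l v)) :
    leftSketch τ s k (res _ β) (res _ x) =
      sumOut (τ.left k \ τ.children k) (coreProduct τ s (τ.left k) x) β := by
  unfold leftSketch subTTNS sumOut
  refine (Finset.sum_nbij' (fun z => res _ z)
    (fun b v => if h : v ∈ τ.incident (τ.left k) then b ⟨v, h⟩ else β v) ?_ ?_ ?_ ?_ ?_).symm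
  · intro z hz
    simp only [Finset.mem_filter, Finset.mem_univ, true_and] at hz ⊢
    intro e
    have he := (τ.mem_boundary_left).1 e.2
    exact hz e (by simp [he])
  · intro b hb
    simp only [Finset.mem_filter, Finset.mem_univ, true_and] at hb ⊢
    intro v hv
    split_ifs with h
    · have h1 := τ.incident_left_subset k h
      have h2 : v ∈ τ.children k := by
        by_contra h2; exact hv (Finset.mem_sdiff.2 ⟨h1, h2⟩)
      exact hb ⟨v, τ.mem_boundary_left.2 h2⟩
    · rfl
  · intro z hz
    simp only [Finset.mem_filter, Finset.mem_univ, true_and] at hz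
    funext v
    dsimp only [res]
    split_ifs with h
    · rfl
    · refine (hz v fun hv => h ?_).symm
      exact τ.mem_incident_self (Finset.mem_sdiff.1 hv).1
  · intro b _
    funext v; simp [res]
  · intro z _
    unfold coreProduct
    rw [← Finset.prod_coe_sort]; rfl

theorem coreProduct_congr {n l : V → ℕ} (s : ∀ k, Core τ n l k) {S : Finset V}
    (x : ∀ v, Fin (n v)) {z z' : ∀ v, Fin (l v)} (hS : ∀ v ∈ S, z v = z' v)
    (hC : ∀ v ∈ S, ∀ w ∈ τ.children v, z w = z' w) :
    coreProduct τ s S x z = coreProduct τ s S x z' := by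
  refine Finset.prod_congr rfl fun v hv => ?_
  rw [hS v hv]
  congr 1
  funext w
  exact hC v hv w w.2

/-- Attaching the core at k and summing over the bonds C(k) completes the contraction to all bonds
in L(k); only the bond above k stays free. -/
theorem edgeSketch_eq_sumOut {n l : V → ℕ} (s : ∀ k, Core τ n l k) (k : V)
    (x : ∀ v, Fin (n v)) (β : ∀ v, Fin (l v)) :
    edgeSketch τ s k (β k) (res _ x) =
      sumOut (τ.left k) (coreProduct τ s (τ.subtree k) x) β := by
  have hk : k ∉ τ.children k := fun h => τ.notMem_left_self k (τ.children_subset_left k h)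
  have h1 : τ.left k = τ.children k ∪ (τ.left k \ τ.children k) := by
    rw [Finset.union_sdiff_of_subset (τ.children_subset_left k)]
  have h2 : ∀ b, (∀ v, v ∉ τ.children k → b v = β v) →
      sumOut (τ.left k \ τ.children k) (coreProduct τ s (τ.subtree k) x) b =
      (fun c : Joint l (τ.children k) => s k (x k) c (β k) * leftSketch τ s k c (res _ x))
        fun v => b v := by
    intro b hb
    change _ = s k (x k) (res _ b) (β k) * leftSketch τ s k (res _ b) (res _ x)
    rw [leftSketch_eq_sumOut]
    rw [← sumOut_mul_left (G := fun z => s k (x k) (res _ z) (z k))]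
    · refine sumOut_congr fun z _ => ?_
      rw [coreProduct, TTNSTree.subtree, Finset.prod_insert (τ.notMem_left_self k)]; rfl
    · intro z hz
      have hzk : z k = β k := by
        rw [hz k (by simp [τ.notMem_left_self k]), hb k hk]
      have hzc : res (τ.children k) z = res (τ.children k) b := by
        funext v
        exact hz v (by simp [v.2])
      rw [hzk, hzc]
  rw [h1, sumOut_union Finset.disjoint_sdiff, sumOut_congr h2]
  exact (sumOut_restrict (X := fun v => Fin (l v)) _ _ _).symm

/-- Branches below distinct children share neither vertices nor bonds, so the contraction
factorises. Positive bond dimensions are what allow β to be extended to a full bond index. -/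
theorem leftSketch_eq_prod {n l : V → ℕ} (hl : ∀ v, 0 < l v) (s : ∀ k, Core τ n l k) (k : V)
    (x : ∀ v, Fin (n v)) (β : Joint l (τ.children k)) :
    leftSketch τ s k β (res _ x) =
      ∏ w : τ.children k, edgeSketch τ s w (β w) (res _ x) := by
  obtain ⟨β, rfl⟩ := exists_res_eq hl β
  have h0 : ∀ w : τ.children k, edgeSketch τ s w (res _ β w) (res _ x) =
      sumOut (τ.left w) (coreProduct τ s (τ.subtree w) x) β := fun w =>
    edgeSketch_eq_sumOut τ s w x β
  rw [leftSketch_eq_sumOut, Finset.prod_congr rfl fun w _ => h0 w,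
    Finset.prod_coe_sort (τ.children k)
      fun w => sumOut (τ.left w) (coreProduct τ s (τ.subtree w) x) β]
  have hS : τ.left k \ τ.children k = (τ.children k).biUnion τ.left := by
    ext v
    rw [Finset.mem_sdiff, τ.left_eq_biUnion, Finset.mem_biUnion, Finset.mem_biUnion]
    constructor
    · rintro ⟨⟨w, hw, hv⟩, hvk⟩
      rcases τ.mem_subtree.1 hv with rfl | hv
      exacts [absurd hw hvk, ⟨w, hw, hv⟩]
    · rintro ⟨w, hw, hv⟩
      refine ⟨⟨w, hw, τ.left_subset_subtree w hv⟩, fun hvk => ?_⟩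
      have := τ.depth_lt_of_mem_left hv
      rw [τ.depth_child hw, τ.depth_child hvk] at this
      exact this.false
  have hd : ∀ i ∈ τ.children k, ∀ j ∈ τ.children k, i ≠ j →
      Disjoint (τ.left i) (τ.subtree j) := fun i hi j hj hij =>
    (τ.disjoint_subtree hi hj hij).mono_left (τ.left_subset_subtree i)
  rw [hS, ← sumOut_prod (τ.children k) τ.left τ.subtree _ _ hd
    fun i hi j hj hij => (hd i hi j hj hij).mono_right (τ.left_subset_subtree j)]
  · congr 1
    funext z
    simp only [coreProduct]
    rw [τ.left_eq_biUnion, Finset.prod_biUnion]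
    exact fun i hi j hj hij => τ.disjoint_subtree hi hj hij
  · intro w _ z z' h
    exact coreProduct_congr τ s x h fun v hv u hu =>
      h u (τ.left_subset_subtree w (τ.child_mem_left hv hu))

/-- Tensors obtained by contracting cores from the leaves to the root form a TTNS. -/
theorem isTTNS_of_recursion {n r : V → ℕ} (hroot : r τ.root = 1) (hr : ∀ v, 0 < r v)
    {p : Tensor n} {G : ∀ k, Core τ n r k} {Φ : ∀ w, Matrix (Joint n (τ.subtree w)) (Fin (r w)) ℝ}
    (hΦ : ∀ k x a, Φ k (res _ x) a = ∑ α : Joint r (τ.children k),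
      (∏ w : τ.children k, Φ w (res _ x) (α w)) * G k (x k) α a)
    (hp : ∀ x a, Φ τ.root (res _ x) a = p x) : IsTTNS τ p G := by
  -- The recursion determines Φ_k as the contraction of the cores in the subtree at k.
  have key : ∀ k x a, Φ k (res _ x) a = edgeSketch τ G k a (res _ x) := by
    intro k
    induction k using τ.induction_children with
    | h k ih =>
      intro x a
      rw [hΦ]
      unfold edgeSketch
      refine Finset.sum_congr rfl fun α _ => ?_
      have h1 := leftSketch_eq_prod τ hr G k x α
      rw [mul_comm]
      refine congrArg (G k (x k) α a * ·) ?_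
      refine Eq.trans ?_ h1.symm
      exact Finset.prod_congr rfl fun w _ => ih w w.2 x (α w)
  intro x
  let β : ∀ v, Fin (r v) := fun v => ⟨0, hr v⟩
  rw [← hp x (β τ.root), key, edgeSketch_eq_sumOut, τ.subtree_root]
  -- The sum leaves the dummy bond at the root fixed; having one value, it imposes no restriction.
  have hsub : Subsingleton (Fin (r τ.root)) := by rw [hroot]; infer_instance
  unfold sumOut coreProduct
  rw [Finset.filter_true_of_mem]
  intro z _ v hv
  rcases eq_or_ne v τ.root with rfl | hne
  · exact Subsingleton.elim _ _
  · have : v ∈ τ.subtree τ.root := by rw [τ.subtree_root]; exact Finset.mem_univ v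
    rcases τ.mem_subtree.1 this with h | h
    exacts [absurd h hne, absurd h hv]

/-- Rotating the bonds of the cores. -/
theorem recursion_rotateCore {n r : V → ℕ} {G : ∀ k, Core τ n r k}
    {Φ : ∀ w, Matrix (Joint n (τ.subtree w)) (Fin (r w)) ℝ}
    {R : ∀ k, Matrix (Fin (r k)) (Fin (r k)) ℝ} (hR : ∀ k, R k * (R k)ᵀ = 1)
    (hΦ : ∀ k x a, Φ k (res _ x) a = ∑ α : Joint r (τ.children k),
      (∏ w : τ.children k, Φ w (res _ x) (α w)) * G k (x k) α a) (k : V) (x : ∀ v, Fin (n v))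
    (a : Fin (r k)) :
    (Φ k * R k) (res _ x) a = ∑ α : Joint r (τ.children k),
      (∏ w : τ.children k, (Φ w * R w) (res _ x) (α w)) * rotateCore τ R (G k) (x k) α a := by
  -- R_w R_wᵀ = 1 is inserted on every child bond.
  have h1 : ∀ (w : V) (c : Fin (r w)), Φ w (res _ x) c =
      ∑ b, (Φ w * R w) (res _ x) b * (R w)ᵀ b c := fun w c => by
    rw [← Matrix.mul_apply, Matrix.mul_assoc, hR, Matrix.mul_one]
  have h2 : ∀ α' : Joint r (τ.children k), ∏ w : τ.children k, Φ w (res _ x) (α' w) =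
      ∑ α : Joint r (τ.children k), (∏ w : τ.children k, (Φ w * R w) (res _ x) (α w)) *
        ∏ w : τ.children k, (R w)ᵀ (α w) (α' w) := fun α' => by
    rw [Finset.prod_congr rfl fun (w : τ.children k) _ => h1 w (α' w), Finset.prod_univ_sum]
    simp [Finset.prod_mul_distrib]
  have h3 : ∀ a', Φ k (res _ x) a' = ∑ α' : Joint r (τ.children k),
      (∑ α : Joint r (τ.children k), (∏ w : τ.children k, (Φ w * R w) (res _ x) (α w)) *
        ∏ w : τ.children k, (R w)ᵀ (α w) (α' w)) * G k (x k) α' a' := fun a' => by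
    rw [hΦ]
    exact Finset.sum_congr rfl fun α' _ => by rw [h2]
  rw [Matrix.mul_apply]
  simp only [h3, rotateCore, Finset.sum_mul, Finset.mul_sum]
  conv_lhs => rw [Finset.sum_comm]; enter [2, α']; rw [Finset.sum_comm]
  rw [Finset.sum_comm]
  refine Finset.sum_congr rfl fun α _ => Finset.sum_congr rfl fun α' _ =>
    Finset.sum_congr rfl fun a' _ => ?_
  ring

end Contraction

end

/-! ### Sketches as matrix products, and their ranks. -/

noncomputable section

section MatrixRank

open Matrix

variable {m n q : Type*} [Fintype m] [Fintype n] [Fintype q]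

/-- Equal ranks force equal kernels, so S can be cancelled. This lifts identities for Z_k to the
tensor sketched from the right only. -/
theorem mul_eq_zero_of_rank_mul_eq [DecidableEq n] {S : Matrix m n ℝ} {P : Matrix n q ℝ}
    [DecidableEq q] (h : (S * P).rank = P.rank) {o : Type*} [Fintype o] [DecidableEq o]
    {N : Matrix q o ℝ} (hN : S * P * N = 0) : P * N = 0 := by
  have hle : LinearMap.ker P.mulVecLin ≤ LinearMap.ker (S * P).mulVecLin := by
    rw [Matrix.mulVecLin_mul]; exact LinearMap.ker_le_ker_comp _ _
  have heq : LinearMap.ker P.mulVecLin = LinearMap.ker (S * P).mulVecLin := by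
    refine Submodule.eq_of_le_of_finrank_eq hle ?_
    have h1 := LinearMap.finrank_range_add_finrank_ker P.mulVecLin
    have h2 := LinearMap.finrank_range_add_finrank_ker (S * P).mulVecLin
    have h3 : Module.finrank ℝ (LinearMap.range (S * P).mulVecLin) =
      Module.finrank ℝ (LinearMap.range P.mulVecLin) := h
    omega
  refine Matrix.ext_of_mulVec_single fun j => ?_
  have : N *ᵥ Pi.single j 1 ∈ LinearMap.ker P.mulVecLin := by
    rw [heq, LinearMap.mem_ker, Matrix.mulVecLin_apply, mulVec_mulVec, hN, zero_mulVec]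
  rw [← mulVec_mulVec, zero_mulVec]
  exact this

theorem exists_eq_mul_of_range_le [DecidableEq q] {A : Matrix m n ℝ}
    {B : Matrix m q ℝ} (h : LinearMap.range B.mulVecLin ≤ LinearMap.range A.mulVecLin) :
    ∃ C : Matrix n q ℝ, B = A * C := by
  have h1 : ∀ j, ∃ c, A *ᵥ c = B *ᵥ Pi.single j 1 := fun j => h ⟨Pi.single j 1, rfl⟩
  choose c hc using h1
  refine ⟨Matrix.of fun i j => c j i, Matrix.ext fun i j => ?_⟩
  have := congrFun (hc j) i
  rw [mulVec_single_one] at this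
  exact this.symm

end MatrixRank

section Sketching

variable {V : Type*} [Fintype V] [DecidableEq V] (τ : TTNSTree V) {n l m r : V → ℕ}

theorem subTTNS_of_eq_empty (s : ∀ k, Core τ n l k) {S : Finset V} (hS : S = ∅)
    (x : Joint n S) (b : Joint l (τ.boundary S)) : subTTNS τ s S x b = 1 := by
  subst hS
  have h1 : τ.boundary ∅ = ∅ := by simp [TTNSTree.boundary]
  have h2 : τ.incident ∅ = ∅ := by simp [TTNSTree.incident]
  have : IsEmpty (τ.boundary ∅) := by rw [h1]; infer_instance
  have : IsEmpty (τ.incident ∅) := by rw [h2]; infer_instance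
  simp [subTTNS]

theorem rightSketch_root (t : ∀ k, Core τ n m k) (x : Joint n (τ.right τ.root))
    (c : Fin (m τ.root)) : rightSketch τ t τ.root x c = 1 := by
  unfold rightSketch
  exact subTTNS_of_eq_empty τ t (by simp [TTNSTree.right, τ.subtree_root]) _ _

/-- The edge sketch is a function of Z_w. Therefore A_k inherits its error from the Z_w alone, with
the norms of the sketch cores as amplification. -/
theorem sketchEdgeZ_eq_mul (s : ∀ k, Core τ n l k) (t : ∀ k, Core τ n m k) (p : Tensor n)
    (w : V) : sketchEdgeZ τ s t p w = sketchCoreMatrix τ (s w) * sketchZ τ s t p w := by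
  ext b c
  rw [Matrix.mul_apply, Fintype.sum_prod_type]
  simp only [sketchEdgeZ, sketchCoreMatrix, sketchZ, edgeSketch, Matrix.of_apply, Finset.mul_sum,
    Finset.sum_mul, Finset.sum_filter]
  rw [Finset.sum_comm]
  refine Finset.sum_congr rfl fun β _ => ?_
  rw [Finset.sum_comm]
  refine Finset.sum_congr rfl fun x _ => ?_
  simp only [mul_ite, mul_zero]
  rw [Finset.sum_ite_eq]
  simp only [Finset.mem_univ, if_true, mul_assoc]
  rfl

theorem sum_rightSketched_mul (t : ∀ k, Core τ n m k) (p : Tensor n) (k : V)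
    (f : Joint n (τ.subtree k) → ℝ) (c : Fin (m k)) :
    ∑ y, f y * rightSketched τ t p k y c =
      ∑ x, f (res _ x) * p x * rightSketch τ t k (res _ x) c := by
  simp only [rightSketched, Matrix.of_apply, Finset.mul_sum, Finset.sum_filter]
  rw [Finset.sum_comm]
  refine Finset.sum_congr rfl fun x _ => ?_
  simp only [mul_ite, mul_zero]
  rw [Finset.sum_ite_eq]
  simp [mul_assoc]

/-- The left sketch at `k` together with the physical index at `k`, as a matrix. -/
def leftSketchMatrix (s : ∀ k, Core τ n l k) (k : V) :
    Matrix (Joint l (τ.children k) × Fin (n k)) (Joint n (τ.subtree k)) ℝ :=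
  Matrix.of fun i y => if y ⟨k, τ.mem_subtree_self k⟩ = i.2 then
    leftSketch τ s k i.1 fun v => y ⟨v, τ.left_subset_subtree k v.2⟩ else 0

theorem sketchZ_eq_mul (s : ∀ k, Core τ n l k) (t : ∀ k, Core τ n m k) (p : Tensor n) (k : V) :
    sketchZ τ s t p k = leftSketchMatrix τ s k * rightSketched τ t p k := by
  ext i c
  rw [Matrix.mul_apply, sum_rightSketched_mul]
  simp only [sketchZ, leftSketchMatrix, Matrix.of_apply, Finset.sum_filter, ite_mul, zero_mul]
  rfl

theorem sketchEdgeZ_eq_mul_rightSketched (s : ∀ k, Core τ n l k) (t : ∀ k, Core τ n m k)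
    (p : Tensor n) (k : V) :
    sketchEdgeZ τ s t p k = Matrix.of (edgeSketch τ s k) * rightSketched τ t p k := by
  ext i c
  rw [Matrix.mul_apply]
  simp only [Matrix.of_apply]
  rw [sum_rightSketched_mul]
  rfl

/-- Identifies the computed matrix with the one in condition (iii), for the left factors selected by
Q. -/
theorem systemA_eq_gaugeA (s : ∀ k, Core τ n l k) (t : ∀ k, Core τ n m k) (p : Tensor n)
    (D : SVDChoice τ n l m r) {Φ : ∀ w, Matrix (Joint n (τ.subtree w)) (Fin (r w)) ℝ}
    (hΦ : ∀ w, w ≠ τ.root → Φ w = rightSketched τ t p w * D.Q w) (k : V) :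
    systemA τ s t p D k = gaugeA τ s Φ k := by
  ext β α
  simp only [systemA, gaugeA, Matrix.of_apply]
  refine Finset.prod_congr rfl fun w _ => ?_
  rw [sketchEdgeZ_eq_mul_rightSketched, Matrix.mul_assoc, ← hΦ w (τ.child_ne_root w.2),
    Matrix.mul_apply]
  rfl

theorem systemA_eq_piKronecker (s : ∀ k, Core τ n l k) (t : ∀ k, Core τ n m k) (p : Tensor n)
    (D : SVDChoice τ n l m r) (k : V) :
    systemA τ s t p D k =
      piKronecker fun w : τ.children k => sketchEdgeZ τ s t p w * D.Q w := rfl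

theorem leftSketch_of_isLeaf (hl : ∀ v, 0 < l v) (s : ∀ k, Core τ n l k) {k : V}
    (hk : τ.IsLeaf k) (x : ∀ v, Fin (n v)) (β : Joint l (τ.children k)) :
    leftSketch τ s k β (res _ x) = 1 := by
  have : IsEmpty (τ.children k) := by
    rw [show τ.children k = ∅ from hk]; infer_instance
  rw [leftSketch_eq_prod τ hl]
  exact Fintype.prod_empty _

theorem res_subtree_eq_iff_of_isLeaf {k : V} (hk : τ.IsLeaf k) (x : ∀ v, Fin (n v))
    (y : Joint n (τ.subtree k)) :
    res (τ.subtree k) x = y ↔ x k = y ⟨k, τ.mem_subtree_self k⟩ := by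
  constructor
  · rintro rfl; rfl
  · intro h
    funext v
    have hv : (v : V) = k := by
      have := v.2
      rw [τ.mem_subtree, τ.left_eq_biUnion, show τ.children k = ∅ from hk] at this
      simpa using this
    obtain ⟨v, hv'⟩ := v
    obtain rfl : v = k := hv
    exact h

/-- Away from leaves the rank of Z_k is an assumption. At a leaf the left sketch is 1, so Z_k is the
right-sketched tensor with relabelled rows, and (i) gives the rank. -/
theorem rank_sketchZ_eq (hl : ∀ v, 0 < l v) {s : ∀ k, Core τ n l k} {t : ∀ k, Core τ n m k}
    {p : Tensor n} (hst : SketchCondition τ r s t p) (hp : TTNSCondition τ r p) {k : V}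
    (hk : k ≠ τ.root) :
    (sketchZ τ s t p k).rank = r k ∧ (rightSketched τ t p k).rank = r k := by
  obtain ⟨Φ, Ψ, h⟩ := hp
  obtain ⟨h1, h2⟩ := hst.same_range Φ Ψ h k hk
  have h3 : (rightSketched τ t p k).rank = r k := by
    rw [← h2, Matrix.rank, Matrix.rank, h1]
  refine ⟨?_, h3⟩
  by_cases hleaf : τ.IsLeaf k
  · refine le_antisymm ?_ ?_
    · rw [← h3, sketchZ_eq_mul]; exact Matrix.rank_mul_le_right _ _
    · let β : Joint l (τ.children k) := fun v => ⟨0, hl v⟩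
      let f : Joint n (τ.subtree k) → Joint l (τ.children k) × Fin (n k) :=
        fun y => (β, y ⟨k, τ.mem_subtree_self k⟩)
      have h4 : rightSketched τ t p k = (sketchZ τ s t p k).submatrix f id := by
        ext y c
        simp only [rightSketched, sketchZ, Matrix.of_apply, Matrix.submatrix_apply, f, id,
          res_subtree_eq_iff_of_isLeaf τ hleaf, leftSketch_of_isLeaf τ hl s hleaf, one_mul]
      have h5 : (sketchZ τ s t p k).submatrix f id =
          Matrix.of (fun y => (1 : Matrix (Joint l (τ.children k) × Fin (n k))
            (Joint l (τ.children k) × Fin (n k)) ℝ) (f y)) * sketchZ τ s t p k := by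
        ext y c
        change sketchZ τ s t p k (f y) c = ((1 : Matrix (Joint l (τ.children k) × Fin (n k))
            (Joint l (τ.children k) × Fin (n k)) ℝ) * sketchZ τ s t p k) (f y) c
        rw [Matrix.one_mul]
      rw [← h3, h4, h5]
      exact Matrix.rank_mul_le_right _ _
  · exact hst.rank_sketchZ k hleaf hk

end Sketching

/-! ### Existence of cores and the sketched linear system. -/

section ExactRecovery

variable {V : Type*} [Fintype V] [DecidableEq V] (τ : TTNSTree V) {n l m r : V → ℕ}

/-- Reproducing kernels acting on disjoint subtrees can be applied one after the other, and each
leaves p unchanged. -/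
theorem sumOut_prod_projection {p : Tensor n}
    {P : ∀ w, Joint n (τ.subtree w) → Joint n (τ.subtree w) → ℝ} {k : V}
    (hP : ∀ w ∈ τ.children k, ∀ x,
      sumOut (τ.subtree w) (fun z => P w (res _ x) (res _ z) * p z) x = p x)
    (W : Finset V) (hW : W ⊆ τ.children k) (x : ∀ v, Fin (n v)) :
    sumOut (W.biUnion τ.subtree) (fun z => (∏ w ∈ W, P w (res _ x) (res _ z)) * p z) x = p x := by
  induction W using Finset.induction_on with
  | empty => simp [sumOut_empty]
  | insert a W ha ih =>
    have haW : a ∈ τ.children k := hW (Finset.mem_insert_self _ _)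
    have hWk : W ⊆ τ.children k := (Finset.subset_insert _ _).trans hW
    have hne : ∀ i ∈ W, i ≠ a := fun i hi h => ha (h ▸ hi)
    have hdis : ∀ i ∈ W, Disjoint (τ.subtree i) (τ.subtree a) := fun i hi =>
      τ.disjoint_subtree (hWk hi) haW (hne i hi)
    have hd : Disjoint (W.biUnion τ.subtree) (τ.subtree a) := by
      rw [Finset.disjoint_biUnion_left]; exact hdis
    rw [Finset.biUnion_insert, Finset.union_comm, sumOut_union hd]
    refine Eq.trans (sumOut_congr fun y hy => ?_) (ih hWk)
    have hres : res (τ.subtree a) x = res (τ.subtree a) y := by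
      funext v
      exact (hy v fun hv => Finset.disjoint_left.1 hd hv v.2).symm
    have h1 : ∀ z, (∀ v, v ∉ τ.subtree a → z v = y v) →
        ∏ w ∈ W, P w (res _ x) (res _ z) = ∏ w ∈ W, P w (res _ x) (res _ y) := fun z hz => by
      refine Finset.prod_congr rfl fun w hw => ?_
      congr 1
      funext v
      exact hz v fun hv => Finset.disjoint_left.1 (hdis w hw) v.2 hv
    conv_rhs => rw [← hP a haW y, ← hres, ← sumOut_mul_left h1]
    refine sumOut_congr fun z _ => ?_
    rw [Finset.prod_insert ha]; ring

/-- Φ L is a projection onto the column space of Φ, which contains the columns of p unfolded along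
the edge above w. -/
theorem sumOut_projection {p : Tensor n} {w : V} {Φ : Matrix (Joint n (τ.subtree w)) (Fin (r w)) ℝ}
    {Ψ : Matrix (Fin (r w)) (Joint n (τ.right w)) ℝ}
    {L : Matrix (Fin (r w)) (Joint n (τ.subtree w)) ℝ} (hL : L * Φ = 1)
    (hp : ∀ x, p x = ∑ a, Φ (res (τ.subtree w) x) a * Ψ a (res (τ.right w) x))
    (x : ∀ v, Fin (n v)) :
    sumOut (τ.subtree w) (fun z => (Φ * L) (res _ x) (res _ z) * p z) x = p x := by
  have h1 : sumOut (τ.subtree w) (fun z => (Φ * L) (res _ x) (res _ z) * p z) x =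
      sumOut (τ.subtree w) (fun z => (fun y => (Φ * L) (res _ x) y *
        (Φ * Ψ) y (res _ x)) fun v => z v) x := by
    refine sumOut_congr fun z hz => ?_
    rw [hp z]
    have : res (τ.right w) z = res (τ.right w) x := by
      funext v
      exact hz v (Finset.mem_compl.1 v.2)
    rw [this]; rfl
  rw [h1]
  refine (sumOut_restrict (X := fun v => Fin (n v)) (τ.subtree w)
    (fun y => (Φ * L) (res _ x) y * (Φ * Ψ) y (res _ x)) x).trans ?_
  rw [← Matrix.mul_apply, Matrix.mul_assoc, ← Matrix.mul_assoc L, hL, Matrix.one_mul, hp x,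
    Matrix.mul_apply]

theorem filter_eq_sumOut (k : V) (F : (∀ v, Fin (n v)) → ℝ) (x : ∀ v, Fin (n v)) :
    ∑ z : (∀ v, Fin (n v)) with z k = x k, F z = sumOut (Finset.univ.erase k) F x := by
  unfold sumOut
  congr 1
  ext z; simp

theorem rightSketched_mul_apply (t : ∀ k, Core τ n m k) (p : Tensor n) (k : V)
    (Q : Matrix (Fin (m k)) (Fin (r k)) ℝ) (x : ∀ v, Fin (n v)) (a : Fin (r k)) :
    (rightSketched τ t p k * Q) (res _ x) a =
      sumOut (τ.right k) (fun z => p z * (Matrix.of (rightSketch τ t k) * Q) (res _ z) a) x := by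
  have h : ∀ z : (∀ v, Fin (n v)), res (τ.subtree k) z = res (τ.subtree k) x ↔
      ∀ v, v ∉ τ.right k → z v = x v := fun z => by
    simp only [TTNSTree.right, Finset.mem_compl, not_not, funext_iff]
    exact ⟨fun h v hv => h ⟨v, hv⟩, fun h v => h v v.2⟩
  simp only [Matrix.mul_apply, rightSketched, Matrix.of_apply, sumOut, h, Finset.sum_mul,
    Finset.mul_sum]
  rw [Finset.sum_comm]
  simp only [mul_assoc]

theorem sketchZ_mul_apply (s : ∀ k, Core τ n l k) (t : ∀ k, Core τ n m k) (p : Tensor n) (k : V)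
    (Q : Matrix (Fin (m k)) (Fin (r k)) ℝ) (x : ∀ v, Fin (n v)) (β : Joint l (τ.children k))
    (a : Fin (r k)) :
    (sketchZ τ s t p k * Q) (β, x k) a = sumOut (τ.left k) (fun z => leftSketch τ s k β (res _ z) *
      (rightSketched τ t p k * Q) (res _ z) a) x := by
  have h1 : (sketchZ τ s t p k * Q) (β, x k) a = ∑ z : (∀ v, Fin (n v)) with z k = x k,
      leftSketch τ s k β (res _ z) * (p z * (Matrix.of (rightSketch τ t k) * Q) (res _ z) a) := by
    simp only [Matrix.mul_apply, sketchZ, Matrix.of_apply, Finset.sum_mul, Finset.mul_sum]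
    rw [Finset.sum_comm]
    simp only [mul_assoc]
  rw [h1, filter_eq_sumOut, ← τ.right_union_left, Finset.union_comm,
    sumOut_union (τ.disjoint_left_right k)]
  refine sumOut_congr fun z _ => ?_
  rw [rightSketched_mul_apply]
  refine sumOut_mul_left fun z' hz' => ?_
  congr 1
  funext v
  exact hz' v (Finset.disjoint_left.1 (τ.disjoint_left_right k) v.2)

/-- The cores solving the sketched equations. -/
theorem exists_core_recursion {p : Tensor n} (t : ∀ k, Core τ n m k)
    {Q : ∀ k, Matrix (Fin (m k)) (Fin (r k)) ℝ}
    {Ψ : ∀ w, Matrix (Fin (r w)) (Joint n (τ.right w)) ℝ}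
    (hdec : IsLowRankDecomposition τ p (fun w => rightSketched τ t p w * Q w) Ψ)
    (hrank : ∀ w, w ≠ τ.root → (rightSketched τ t p w * Q w).rank = r w) (k : V) :
    ∃ G : Core τ n r k, ∀ x a, (rightSketched τ t p k * Q k) (res _ x) a =
      ∑ α : Joint r (τ.children k),
        (∏ w : τ.children k, (rightSketched τ t p w * Q w) (res _ x) (α w)) * G (x k) α a := by
  set Φ : ∀ w, Matrix (Joint n (τ.subtree w)) (Fin (r w)) ℝ :=
    fun w => rightSketched τ t p w * Q w with hΦ
  let L := fun w => pinv (Φ w)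
  have hL : ∀ w, w ≠ τ.root → L w * Φ w = 1 := fun w hw =>
    pinv_mul_self_of_rank (by rw [Fintype.card_fin]; exact hrank w hw)
  let C := Matrix.of (rightSketch τ t k) * Q k
  -- The core is p with left inverses L_w applied on the child branches and the right sketch
  -- followed by Q_k on R(k). Contracting it with the Φ_w produces the projections Φ_w L_w, which
  -- fix p.
  refine ⟨fun i α a => ∑ z : (∀ v, Fin (n v)) with z k = i,
    (∏ w : τ.children k, L w (α w) (res _ z)) * (p z * C (res _ z) a), fun x a => ?_⟩
  have h1 : ∀ z : (∀ v, Fin (n v)), ∑ α : Joint r (τ.children k),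
      (∏ w : τ.children k, Φ w (res _ x) (α w)) * (∏ w : τ.children k, L w (α w) (res _ z)) =
      ∏ w ∈ τ.children k, (Φ w * L w) (res _ x) (res _ z) := fun z => by
    rw [← Finset.prod_coe_sort]
    simp only [Matrix.mul_apply, ← Finset.prod_mul_distrib]
    rw [Finset.prod_univ_sum]; simp
  have h2 : ∑ α : Joint r (τ.children k), (∏ w : τ.children k, Φ w (res _ x) (α w)) *
      (∑ z : (∀ v, Fin (n v)) with z k = x k,
        (∏ w : τ.children k, L w (α w) (res _ z)) * (p z * C (res _ z) a)) =
      ∑ z : (∀ v, Fin (n v)) with z k = x k,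
        (∏ w ∈ τ.children k, (Φ w * L w) (res _ x) (res _ z)) * (p z * C (res _ z) a) := by
    simp only [Finset.mul_sum, ← h1, Finset.sum_mul]
    rw [Finset.sum_comm]
    simp only [mul_assoc]
  refine Eq.trans ?_ h2.symm
  rw [filter_eq_sumOut, ← τ.right_union_left, sumOut_union (τ.disjoint_left_right k).symm]
  rw [hΦ, rightSketched_mul_apply]
  refine sumOut_congr fun y hy => ?_
  have hproj := sumOut_prod_projection τ (p := p) (P := fun w => Φ w * L w) (k := k)
    (fun w hw => sumOut_projection τ (hL w (τ.child_ne_root hw)) (hdec w (τ.child_ne_root hw)))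
    (τ.children k) subset_rfl y
  rw [← τ.left_eq_biUnion] at hproj
  conv_lhs => rw [← hproj, mul_comm]
  have hCz : ∀ z : (∀ v, Fin (n v)), (∀ v, v ∉ τ.left k → z v = y v) →
      C (res _ z) a = C (res _ y) a := fun z hz => by
    congr 1
    funext v
    exact hz v fun hv => Finset.disjoint_left.1 (τ.disjoint_left_right k) hv v.2
  rw [← sumOut_mul_left hCz]
  refine sumOut_congr fun z _ => ?_
  have hres : ∀ w ∈ τ.children k, res (τ.subtree w) x = res (τ.subtree w) y := fun w hw => by
    funext v
    exact (hy v fun hv => Finset.disjoint_left.1 (τ.disjoint_left_right k)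
      (τ.subtree_subset_left hw v.2) hv).symm
  have h3 : ∏ w ∈ τ.children k, (Φ w * L w) (res _ x) (res _ z) =
      ∏ w ∈ τ.children k, (Φ w * L w) (res _ y) (res _ z) :=
    Finset.prod_congr rfl fun w hw => by rw [hres w hw]
  rw [h3]; ring

/-- Sketching the recursion for the left factors gives the linear system of the algorithm. -/
theorem gaugeA_mul_coreMatrix (hl : ∀ v, 0 < l v) (hn : ∀ v, 0 < n v) {p : Tensor n}
    (s : ∀ k, Core τ n l k) (t : ∀ k, Core τ n m k) {Q : ∀ k, Matrix (Fin (m k)) (Fin (r k)) ℝ}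
    {k : V} {G : Core τ n r k} (hG : ∀ x a, (rightSketched τ t p k * Q k) (res _ x) a =
      ∑ α : Joint r (τ.children k),
        (∏ w : τ.children k, (rightSketched τ t p w * Q w) (res _ x) (α w)) * G (x k) α a)
    (β : Joint l (τ.children k)) (i : Fin (n k)) (a : Fin (r k)) :
    (gaugeA τ s (fun w => rightSketched τ t p w * Q w) k * coreMatrix τ G) β (i, a) =
      (sketchZ τ s t p k * Q k) (β, i) a := by
  set Φ : ∀ w, Matrix (Joint n (τ.subtree w)) (Fin (r w)) ℝ :=
    fun w => rightSketched τ t p w * Q w with hΦ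
  have hG' : ∀ x a, Φ k (res _ x) a = ∑ α : Joint r (τ.children k),
    (∏ w : τ.children k, Φ w (res _ x) (α w)) * G (x k) α a := hG
  obtain ⟨x, rfl⟩ : ∃ x : ∀ v, Fin (n v), x k = i :=
    ⟨Function.update (fun v => ⟨0, hn v⟩) k i, by simp⟩
  rw [sketchZ_mul_apply]
  have h1 : sumOut (τ.left k) (fun z => leftSketch τ s k β (res _ z) * (Φ k) (res _ z) a) x =
      sumOut (τ.left k) (fun z => ∑ α : Joint r (τ.children k), G (x k) α a *
        ∏ w : τ.children k, edgeSketch τ s w (β w) (res _ z) * Φ w (res _ z) (α w)) x := by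
    refine sumOut_congr fun z hz => ?_
    rw [hG', leftSketch_eq_prod τ hl, Finset.mul_sum, hz k (τ.notMem_left_self k)]
    refine Finset.sum_congr rfl fun α _ => ?_
    rw [Finset.prod_mul_distrib]; ring
  rw [h1, sumOut, Finset.sum_comm, Matrix.mul_apply]
  refine Finset.sum_congr rfl fun α _ => ?_
  rw [← Finset.mul_sum, mul_comm]
  refine congrArg (G (x k) α a * ·) ?_
  -- The sum over the variables in L(k) splits into sums over the subtrees of the children.
  change gaugeA τ s Φ k β α = sumOut (τ.left k) (fun z => ∏ w : τ.children k,
    edgeSketch τ s w (β w) (res _ z) * Φ w (res _ z) (α w)) x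
  have hd : ∀ w ∈ (Finset.univ : Finset (τ.children k)), ∀ w' ∈ Finset.univ, w ≠ w' →
      Disjoint (τ.subtree w) (τ.subtree w') := fun w _ w' _ h =>
    τ.disjoint_subtree w.2 w'.2 fun h' => h (Subtype.ext h')
  have hU : τ.left k = (Finset.univ : Finset (τ.children k)).biUnion fun w => τ.subtree w := by
    rw [τ.left_eq_biUnion]
    ext v; simp
  rw [hU, sumOut_prod Finset.univ (fun w : τ.children k => τ.subtree w) (fun w => τ.subtree w)
    _ _ hd hd]
  · refine Finset.prod_congr rfl fun w _ => ?_
    exact (sumOut_restrict (X := fun v => Fin (n v)) (τ.subtree w)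
      (fun y => edgeSketch τ s w (β w) y * Φ w y (α w)) x).symm
  · intro w _ z z' h
    have : res (τ.subtree (w : V)) z = res (τ.subtree w) z' := by
      funext v; exact h v v.2
    rw [this]

end ExactRecovery

end

/-! ### Exact recovery by the algorithm. -/

noncomputable section

section Recovery

variable {V : Type*} [Fintype V] [DecidableEq V] (τ : TTNSTree V) {n l m r : V → ℕ}

theorem bond_pos (hroot : r τ.root = 1) {p : Tensor n} (hp0 : p ≠ 0) (hp : TTNSCondition τ r p)
    (v : V) : 0 < r v := by
  rcases eq_or_ne v τ.root with rfl | hv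
  · omega
  · obtain ⟨Φ, Ψ, h⟩ := hp
    by_contra h0
    refine hp0 (funext fun x => ?_)
    have : IsEmpty (Fin (r v)) := by
      rw [Nat.eq_zero_of_not_pos h0]; infer_instance
    rw [h v hv x]; simp

/-- A matrix with at least one column and full column rank has a row, and a row index at the parent
contains an index of the bond v. -/
theorem sketch_bond_pos (hl : l τ.root = 1) (hr : ∀ v, 0 < r v) {p : Tensor n}
    (hp : TTNSCondition τ r p) {s : ∀ k, Core τ n l k} {t : ∀ k, Core τ n m k}
    (hst : SketchCondition τ r s t p) (v : V) : 0 < l v := by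
  rcases eq_or_ne v τ.root with rfl | hv
  · omega
  · obtain ⟨Φ, Ψ, h⟩ := hp
    have hvc : v ∈ τ.children (τ.parent v) := τ.mem_children.2 ⟨hv, rfl⟩
    have hleaf : ¬ τ.IsLeaf (τ.parent v) := Finset.ne_empty_of_mem hvc
    have h1 := hst.full_column_rank Φ Ψ h _ hleaf
    have h2 : 0 < Fintype.card (Joint r (τ.children (τ.parent v))) :=
      Fintype.card_pos_iff.2 ⟨fun w => ⟨0, hr w⟩⟩
    have h3 := (gaugeA τ s Φ (τ.parent v)).rank_le_card_height
    have h4 : 0 < Fintype.card (Joint l (τ.children (τ.parent v))) := by omega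
    obtain ⟨β⟩ := Fintype.card_pos_iff.1 h4
    exact Fin.pos (β ⟨v, hvc⟩)

/-- The gauge matrices `Q_k`, extended by a matrix of ones at the root. -/
def SVDChoice.extQ {τ : TTNSTree V} (D : SVDChoice τ n l m r) (k : V) :
    Matrix (Fin (m k)) (Fin (r k)) ℝ :=
  if k = τ.root then Matrix.of fun _ _ => 1 else D.Q k

/-- Makes B_k = Z_k Q_k valid at the root as well, so that the root needs no separate recursion. -/
theorem systemB_eq_mul (s : ∀ k, Core τ n l k) (t : ∀ k, Core τ n m k) (p : Tensor n)
    {D : SVDChoice τ n l m r} {k : V} (hk : k ≠ τ.root →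
      IsTruncatedSVD (sketchZ τ s t p k) (D.U k) (D.σ k) (D.V k) ∧ ∀ i, 0 < D.σ k i) :
    systemB τ s t p D k = sketchZ τ s t p k * D.extQ k := by
  by_cases h : k = τ.root
  · ext i a
    simp [systemB, SVDChoice.extQ, h, Matrix.mul_apply]
  · rw [systemB, SVDChoice.extQ, if_neg h, if_neg h]
    exact ((hk h).1.mul_mul_diagonal_inv (hk h).2).symm

theorem systemA_of_isLeaf_transpose_mul_self (s : ∀ k, Core τ n l k)
    (t : ∀ k, Core τ n m k) (p : Tensor n) (D : SVDChoice τ n l m r) {k : V} (hk : τ.IsLeaf k) :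
    (systemA τ s t p D k)ᵀ * systemA τ s t p D k = 1 := by
  have : IsEmpty (τ.children k) := by
    rw [show τ.children k = ∅ from hk]; infer_instance
  ext α α'
  obtain rfl : α = α' := Subsingleton.elim _ _
  simp [Matrix.mul_apply, systemA, Joint]

theorem systemA_mul_of_isLeaf (s : ∀ k, Core τ n l k) (t : ∀ k, Core τ n m k) (p : Tensor n)
    (D : SVDChoice τ n l m r) {k : V} (hk : τ.IsLeaf k) (G : Core τ n r k)
    (β : Joint l (τ.children k)) (i : Fin (n k)) (a : Fin (r k)) (α : Joint r (τ.children k)) :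
    (systemA τ s t p D k * coreMatrix τ G) β (i, a) = G i α a := by
  have : IsEmpty (τ.children k) := by
    rw [show τ.children k = ∅ from hk]; infer_instance
  rw [Matrix.mul_apply, Fintype.sum_subsingleton _ α]
  simp [systemA, coreMatrix]

/-- At a leaf A_k is the 1 × 1 identity, so the leaf rule solves the same system and all vertices
can be treated alike. -/
theorem IsSketchOutput.normal_eq {s : ∀ k, Core τ n l k} {t : ∀ k, Core τ n m k} {p : Tensor n}
    {D : SVDChoice τ n l m r} {G : ∀ k, Core τ n r k} (h : IsSketchOutput τ s t p D G)
    (hr : ∀ v, 0 < r v) (k : V) : (systemA τ s t p D k)ᵀ *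
      (systemA τ s t p D k * coreMatrix τ (G k) - systemB' τ s t p D k) = 0 := by
  by_cases hk : τ.IsLeaf k
  · have : systemA τ s t p D k * coreMatrix τ (G k) = systemB' τ s t p D k := by
      ext β i
      rw [← Prod.mk.eta (p := i), systemA_mul_of_isLeaf τ s t p D hk (G k) β i.1 i.2
        (fun v => ⟨0, hr v⟩), h.leaf k hk β]
      rfl
    rw [this, sub_self, Matrix.mul_zero]
  · exact (h.nonleaf k hk).normal_eq

/-- The sketched algorithm recovers a tensor satisfying the TTNS and sketch conditions. -/
theorem IsSketchOutput.recovery {s : ∀ k, Core τ n l k} {t : ∀ k, Core τ n m k} {p : Tensor n}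
    {D : SVDChoice τ n l m r} {G : ∀ k, Core τ n r k} (h : IsSketchOutput τ s t p D G)
    (hm : m τ.root = 1) (hn : ∀ v, 0 < n v) (hl : ∀ v, 0 < l v) (hr : ∀ v, 0 < r v)
    (hp : TTNSCondition τ r p) (hst : SketchCondition τ r s t p) :
    (∀ x a, (rightSketched τ t p τ.root * D.extQ τ.root) (res _ x) a = p x) ∧
    (∀ k x a, (rightSketched τ t p k * D.extQ k) (res _ x) a = ∑ α : Joint r (τ.children k),
      (∏ w : τ.children k, (rightSketched τ t p w * D.extQ w) (res _ x) (α w)) *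
        G k (x k) α a) ∧
    (∀ k, ¬ τ.IsLeaf k →
      (systemA τ s t p D k).rank = Fintype.card (Joint r (τ.children k))) ∧
    ∀ k, systemA τ s t p D k * coreMatrix τ (G k) = systemB' τ s t p D k := by
  have hsvd : ∀ k, k ≠ τ.root →
      IsTruncatedSVD (sketchZ τ s t p k) (D.U k) (D.σ k) (D.V k) ∧ ∀ i, 0 < D.σ k i :=
    fun k hk => ⟨h.svd k hk, ((h.svd k hk).of_rank_eq (rank_sketchZ_eq τ hl hst hp hk).1).1⟩
  have hQ : ∀ k, k ≠ τ.root → D.extQ k = D.Q k := fun k hk => if_neg hk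
  have hroot : ∀ x a, (rightSketched τ t p τ.root * D.extQ τ.root) (res _ x) a = p x := by
    intro x a
    rw [rightSketched_mul_apply]
    have he : τ.right τ.root = ∅ := by simp [TTNSTree.right, τ.subtree_root]
    have : ∀ F : (∀ v, Fin (n v)) → ℝ, sumOut (τ.right τ.root) F x = F x := fun F => by
      rw [he, sumOut_empty]
    rw [this, Matrix.mul_apply]
    simp [rightSketch_root, SVDChoice.extQ, hm]
  obtain ⟨Φ₀, Ψ₀, hdec₀⟩ := hp
  have hp : TTNSCondition τ r p := ⟨Φ₀, Ψ₀, hdec₀⟩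
  have hex : ∀ w, ∃ Ψ : Matrix (Fin (r w)) (Joint n (τ.right w)) ℝ, w ≠ τ.root →
      ∀ x, p x = ∑ a, (rightSketched τ t p w * D.extQ w) (res _ x) a * Ψ a (res _ x) := by
    intro w
    by_cases hw : w = τ.root
    · exact ⟨0, fun h => absurd hw h⟩
    obtain ⟨C, hC⟩ := exists_eq_mul_of_range_le (A := rightSketched τ t p w) (B := Φ₀ w)
      (hst.same_range Φ₀ Ψ₀ hdec₀ w hw).1.ge
    have hrk := rank_sketchZ_eq τ hl hst hp hw
    -- Z V Vᵀ = Z holds at full rank; the left sketch is cancelled because it preserves the rank.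
    have hVV : rightSketched τ t p w * (D.V w * (D.V w)ᵀ) = rightSketched τ t p w := by
      have h1 := ((h.svd w hw).of_rank_eq hrk.1).2.2
      rw [sketchZ_eq_mul] at h1
      have h2 := mul_eq_zero_of_rank_mul_eq (S := leftSketchMatrix τ s w)
        (P := rightSketched τ t p w) (by rw [← sketchZ_eq_mul, hrk.1, hrk.2])
        (N := D.V w * (D.V w)ᵀ - 1) (by rw [Matrix.mul_sub, h1, Matrix.mul_one, sub_self])
      rwa [Matrix.mul_sub, Matrix.mul_one, sub_eq_zero] at h2
    have hσ : Matrix.diagonal (fun i => (D.σ w i)⁻¹) * Matrix.diagonal (D.σ w) = 1 := by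
      rw [Matrix.diagonal_mul_diagonal]
      have : (fun i => (D.σ w i)⁻¹ * D.σ w i) = fun _ => 1 := by
        ext i; exact inv_mul_cancel₀ ((hsvd w hw).2 i).ne'
      rw [this]; simp
    have hQV : rightSketched τ t p w * D.Q w * (Matrix.diagonal (D.σ w) * (D.V w)ᵀ) =
        rightSketched τ t p w := by
      calc _ = rightSketched τ t p w * (D.V w * (Matrix.diagonal (fun i => (D.σ w i)⁻¹) *
            Matrix.diagonal (D.σ w)) * (D.V w)ᵀ) := by
            simp only [SVDChoice.Q, Matrix.mul_assoc]
        _ = rightSketched τ t p w := by rw [hσ, Matrix.mul_one, hVV]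
    -- By (i), Φ₀ = Φ̄ C, and Φ̄ = (Φ̄ Q)(Σ Vᵀ); so Φ₀ Ψ₀ = (Φ̄ Q)(Σ Vᵀ C Ψ₀).
    refine ⟨Matrix.diagonal (D.σ w) * (D.V w)ᵀ * (C * Ψ₀ w), fun _ x => ?_⟩
    rw [hdec₀ w hw x, ← Matrix.mul_apply, ← Matrix.mul_apply, hC, hQ w hw, ← Matrix.mul_assoc,
      hQV, Matrix.mul_assoc]
  choose Ψ hΨ using hex
  have hdec : IsLowRankDecomposition τ p (fun w => rightSketched τ t p w * D.extQ w) Ψ :=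
    fun w hw x => hΨ w hw x
  -- Condition (i) is used a second time, now for the newly built decomposition.
  have hrank : ∀ w, w ≠ τ.root → (rightSketched τ t p w * D.extQ w).rank = r w := fun w hw =>
    (hst.same_range _ Ψ hdec w hw).2
  have hA : ∀ k, systemA τ s t p D k =
      gaugeA τ s (fun w => rightSketched τ t p w * D.extQ w) k := fun k =>
    systemA_eq_gaugeA τ s t p D (fun w hw => by simp only [hQ w hw]) k
  have hArank : ∀ k, ¬ τ.IsLeaf k →
      (systemA τ s t p D k).rank = Fintype.card (Joint r (τ.children k)) := fun k hk => by
    rw [hA]; exact hst.full_column_rank _ Ψ hdec k hk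
  have hB : ∀ k, systemB τ s t p D k = sketchZ τ s t p k * D.extQ k := fun k =>
    systemB_eq_mul τ s t p (hsvd k)
  have hcore : ∀ k, ∃ G' : Core τ n r k, (∀ x a, (rightSketched τ t p k * D.extQ k) (res _ x) a =
      ∑ α : Joint r (τ.children k),
        (∏ w : τ.children k, (rightSketched τ t p w * D.extQ w) (res _ x) (α w)) * G' (x k) α a) ∧
      systemA τ s t p D k * coreMatrix τ G' = systemB' τ s t p D k := fun k => by
    obtain ⟨G', hG'⟩ := exists_core_recursion τ t hdec hrank k
    refine ⟨G', hG', ?_⟩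
    ext β ⟨i, a⟩
    rw [hA, gaugeA_mul_coreMatrix τ hl hn s t hG' β i a, ← hB]
    rfl
  have hGeq : ∀ k, ∀ G' : Core τ n r k,
      systemA τ s t p D k * coreMatrix τ G' = systemB' τ s t p D k → G' = G k := by
    intro k G' hG'
    have hinv : ∃ X : Matrix (Joint r (τ.children k)) (Joint l (τ.children k)) ℝ,
        X * systemA τ s t p D k = 1 ∧
        X * systemB' τ s t p D k = X * (systemA τ s t p D k * coreMatrix τ (G k)) := by
      have hne := h.normal_eq τ hr k
      rw [Matrix.mul_sub, sub_eq_zero] at hne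
      by_cases hk : τ.IsLeaf k
      · exact ⟨(systemA τ s t p D k)ᵀ, systemA_of_isLeaf_transpose_mul_self τ s t p D hk,
          hne.symm⟩
      · have h1 := pinv_mul_self_of_rank (hArank k hk)
        set A := systemA τ s t p D k
        -- Exhibiting Aᵀ on the right of A† lets the normal equations give A†B = A†A G.
        have hX : pinv A = pinv A * (pinv A)ᵀ * Aᵀ := by
          have h2 := (pinv_isMoorePenrose A).symm_left
          rw [Matrix.transpose_mul] at h2
          rw [Matrix.mul_assoc, h2, ← Matrix.mul_assoc, h1, Matrix.one_mul]
        refine ⟨pinv A, h1, ?_⟩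
        rw [hX, Matrix.mul_assoc, Matrix.mul_assoc, ← hne]
        simp only [Matrix.mul_assoc]
    obtain ⟨X, hX1, hX2⟩ := hinv
    have : coreMatrix τ G' = coreMatrix τ (G k) := by
      rw [← hG', ← Matrix.mul_assoc, ← Matrix.mul_assoc, hX1, Matrix.one_mul, Matrix.one_mul] at hX2
      exact hX2
    funext i α a
    exact congrFun (congrFun this α) (i, a)
  refine ⟨hroot, fun k => ?_, hArank, fun k => ?_⟩
  · obtain ⟨G', h1, h2⟩ := hcore k
    rw [← hGeq k G' h2]; exact h1
  · obtain ⟨G', h1, h2⟩ := hcore k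
    rw [← hGeq k G' h2]; exact h2

end Recovery

end

/-! ### Error propagation to a single core. -/

noncomputable section

section ErrorBound

open Matrix

theorem opNorm_submatrix_le {m n o : Type*} [Fintype m] [Fintype n] [DecidableEq n] [Fintype o]
    [DecidableEq m] (M : Matrix m n ℝ) {f : o → m} (hf : Function.Injective f) :
    ‖M.submatrix f id‖ ≤ ‖M‖ := by
  refine opNorm_le_of_dotProduct_le (norm_nonneg _) fun v => ?_
  refine le_trans ?_ (dotProduct_mulVec_le M v)
  change ∑ i, (M *ᵥ v) (f i) * (M *ᵥ v) (f i) ≤ ∑ i, (M *ᵥ v) i * (M *ᵥ v) i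
  rw [← Finset.sum_image (f := fun i => (M *ᵥ v) i * (M *ᵥ v) i) (hf.injOn)]
  exact Finset.sum_le_sum_of_subset_of_nonneg (Finset.subset_univ _)
    fun i _ _ => mul_self_nonneg _

theorem opNorm_orthogonal_mul_mul {m n : Type*} [Fintype m] [Fintype n] [DecidableEq m]
    [DecidableEq n] {O : Matrix m m ℝ} {P : Matrix n n ℝ} (hO : Oᵀ * O = 1) (hO' : O * Oᵀ = 1)
    (hP : Pᵀ * P = 1) (hP' : P * Pᵀ = 1) (M : Matrix m n ℝ) : ‖O * M * P‖ = ‖M‖ := by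
  have key : ∀ {O : Matrix m m ℝ} {P : Matrix n n ℝ}, Oᵀ * O = 1 → Pᵀ * P = 1 →
      ∀ M : Matrix m n ℝ, ‖O * M * P‖ ≤ ‖M‖ := by
    intro O P hO hP M
    calc ‖O * M * P‖ ≤ ‖O * M‖ * ‖P‖ := l2_opNorm_mul _ _
      _ ≤ ‖O‖ * ‖M‖ * ‖P‖ := by gcongr; exact l2_opNorm_mul _ _
      _ ≤ 1 * ‖M‖ * 1 := by
        gcongr
        · exact opNorm_le_one_of_transpose_mul_self hO
        · exact opNorm_le_one_of_transpose_mul_self hP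
      _ = ‖M‖ := by ring
  refine le_antisymm (key hO hP M) ?_
  have h1 := key (O := Oᵀ) (P := Pᵀ) (by simpa using hO') (by simpa using hP') (O * M * P)
  have h2 : Oᵀ * (O * M * P) * Pᵀ = M := by
    rw [Matrix.mul_assoc O, ← Matrix.mul_assoc Oᵀ, hO, Matrix.one_mul, Matrix.mul_assoc, hP',
      Matrix.mul_one]
  rwa [h2] at h1

variable {V : Type*} [Fintype V] [DecidableEq V] (τ : TTNSTree V) {n l m r : V → ℕ}

/-- The slice `G(·; x; ·)` of a core. -/
def slice {k : V} (G : Core τ n r k) (x : Fin (n k)) :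
    Matrix (Joint r (τ.children k)) (Fin (r k)) ℝ := Matrix.of (G x)

theorem opNorm_slice_le {k : V} (G : Core τ n r k) (x : Fin (n k)) :
    ‖slice τ G x‖ ≤ triNorm τ G :=
  le_ciSup (f := fun x => ‖slice τ G x‖) (Set.finite_range _).bddAbove x

theorem triNorm_le {k : V} {G : Core τ n r k} {c : ℝ} (hc : 0 ≤ c) (h : ∀ x, ‖slice τ G x‖ ≤ c) :
    triNorm τ G ≤ c := Real.iSup_le h hc

theorem triNorm_nonneg {k : V} (G : Core τ n r k) : 0 ≤ triNorm τ G :=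
  Real.iSup_nonneg fun _ => norm_nonneg _

/-- A core of norm zero vanishes and would annihilate the whole contraction. -/
theorem triNorm_pos_of_isTTNS {p : Tensor n} (hp : p ≠ 0) {G : ∀ k, Core τ n r k}
    (h : IsTTNS τ p G) (k : V) : 0 < triNorm τ (G k) := by
  refine lt_of_le_of_ne (triNorm_nonneg τ _) fun h0 => hp ?_
  have hG : ∀ x α a, G k x α a = 0 := fun x α a => by
    have h1 := opNorm_slice_le τ (G k) x
    rw [← h0, norm_le_zero_iff] at h1
    exact congrFun (congrFun h1 α) a
  funext x
  rw [h x]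
  exact Finset.sum_eq_zero fun α _ =>
    Finset.prod_eq_zero (Finset.mem_univ k) (hG _ _ _)

theorem slice_rotateCore (R : ∀ k, Matrix (Fin (r k)) (Fin (r k)) ℝ) {k : V} (G : Core τ n r k)
    (x : Fin (n k)) : slice τ (rotateCore τ R G) x =
      (piKronecker fun w : τ.children k => R w)ᵀ * slice τ G x * R k := by
  ext α a
  simp only [Matrix.mul_apply, transpose_piKronecker, piKronecker_apply, Finset.sum_mul]
  rw [Finset.sum_comm]
  rfl

theorem piKronecker_orthogonal {R : ∀ k, Matrix (Fin (r k)) (Fin (r k)) ℝ}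
    (hR : ∀ k, (R k)ᵀ * R k = 1) (S : Finset V) :
    (piKronecker fun w : S => R w)ᵀ * (piKronecker fun w : S => R w) = 1 := by
  rw [transpose_piKronecker, piKronecker_mul, funext fun w : S => hR w, piKronecker_one]

theorem piKronecker_orthogonal' {R : ∀ k, Matrix (Fin (r k)) (Fin (r k)) ℝ}
    (hR : ∀ k, R k * (R k)ᵀ = 1) (S : Finset V) :
    (piKronecker fun w : S => R w) * (piKronecker fun w : S => R w)ᵀ = 1 := by
  rw [transpose_piKronecker, piKronecker_mul, funext fun w : S => hR w, piKronecker_one]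

theorem triNorm_rotateCore {R : ∀ k, Matrix (Fin (r k)) (Fin (r k)) ℝ}
    (hR : ∀ k, (R k)ᵀ * R k = 1) (hR' : ∀ k, R k * (R k)ᵀ = 1) {k : V} (G : Core τ n r k) :
    triNorm τ (rotateCore τ R G) = triNorm τ G := by
  refine congrArg iSup (funext fun x => ?_)
  change ‖slice τ (rotateCore τ R G) x‖ = ‖slice τ G x‖
  rw [slice_rotateCore]
  refine opNorm_orthogonal_mul_mul ?_ ?_ (hR k) (hR' k) _
  · rw [transpose_transpose]; exact piKronecker_orthogonal' hR' _
  · rw [transpose_transpose]; exact piKronecker_orthogonal hR _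

theorem card_children_le_cC (k : V) : (τ.children k).card ≤ cC τ :=
  Finset.le_sup (f := fun k => (τ.children k).card) (Finset.mem_univ k)

theorem one_le_cC [Nontrivial V] : 1 ≤ cC τ :=
  (Finset.card_pos.2 (Finset.nonempty_iff_ne_empty.2 τ.not_isLeaf_root)).trans_le
    (card_children_le_cC τ τ.root)

theorem cS_eq_prod (s : ∀ k, Core τ n l k) (k : V) :
    cS τ s k = ∏ w : τ.children k, ‖sketchCoreMatrix τ (s w)‖ := by
  rw [Finset.prod_coe_sort (τ.children k) fun w => ‖sketchCoreMatrix τ (s w)‖, cS]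
  split_ifs with h
  · rw [show τ.children k = ∅ from h, Finset.prod_empty]
  · rfl

theorem cS_nonneg (s : ∀ k, Core τ n l k) (k : V) : 0 ≤ cS τ s k := by
  rw [cS_eq_prod]; exact Finset.prod_nonneg fun _ _ => norm_nonneg _

theorem cA_nonneg (s : ∀ k, Core τ n l k) (t : ∀ k, Core τ n m k) (p : Tensor n)
    (D : SVDChoice τ n l m r) (k : V) : 0 ≤ cA τ s t p D k := by
  unfold cA; split_ifs <;> positivity

theorem cG_nonneg {k : V} (G : Core τ n r k) : 0 ≤ cG τ G :=
  one_div_nonneg.2 (triNorm_nonneg τ G)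

theorem xi_le_one (s : ∀ k, Core τ n l k) (t : ∀ k, Core τ n m k) (p : Tensor n)
    (D : SVDChoice τ n l m r) (G : ∀ k, Core τ n r k) : xi τ s t p D G ≤ 1 := min_le_left _ _

theorem xi_nonneg (s : ∀ k, Core τ n l k) (t : ∀ k, Core τ n m k) (p : Tensor n)
    (D : SVDChoice τ n l m r) (G : ∀ k, Core τ n r k) : 0 ≤ xi τ s t p D G := by
  refine le_min zero_le_one (Real.iInf_nonneg fun i => ?_)
  have h1 := cA_nonneg τ s t p D i
  have h2 := cS_nonneg τ s i
  have h3 := cG_nonneg τ (G i)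
  positivity

theorem mul_xi_le_one (s : ∀ k, Core τ n l k) (t : ∀ k, Core τ n m k) (p : Tensor n)
    (D : SVDChoice τ n l m r) (G : ∀ k, Core τ n r k) (k : V) :
    2 * cA τ s t p D k * (cS τ s k + cG τ (G k)) * xi τ s t p D G ≤ 1 := by
  have h1 := cA_nonneg τ s t p D k
  have h2 := cS_nonneg τ s k
  have h3 := cG_nonneg τ (G k)
  have h4 : xi τ s t p D G ≤ (2 * cA τ s t p D k * (cS τ s k + cG τ (G k)))⁻¹ :=
    (min_le_right _ _).trans (ciInf_le (Set.finite_range _).bddBelow k)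
  exact (mul_le_mul_of_nonneg_left h4 (by positivity)).trans mul_inv_le_one

/-- Full column rank gives A†A = 1. The lower-bound form, unlike one stated with A†, passes directly
to A_k times an orthogonal matrix. -/
theorem norm_le_cA_mul (s : ∀ k, Core τ n l k) (t : ∀ k, Core τ n m k) (p : Tensor n)
    (D : SVDChoice τ n l m r) {k : V} (hA : ¬ τ.IsLeaf k →
      (systemA τ s t p D k).rank = Fintype.card (Joint r (τ.children k)))
    (v : Joint r (τ.children k) → ℝ) :
    ‖WithLp.toLp 2 v‖ ≤ cA τ s t p D k * ‖WithLp.toLp 2 (systemA τ s t p D k *ᵥ v)‖ := by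
  by_cases hk : τ.IsLeaf k
  · rw [cA, if_pos hk, one_mul]
    refine le_of_sq_le_sq ?_ (norm_nonneg _)
    rw [norm_toLp_sq, norm_toLp_sq, mulVec_dotProduct_mulVec,
      systemA_of_isLeaf_transpose_mul_self τ s t p D hk, one_mulVec]
  · rw [cA, if_neg hk]
    have h1 := norm_toLp_mulVec_le (pinv (systemA τ s t p D k)) (systemA τ s t p D k *ᵥ v)
    rwa [mulVec_mulVec, pinv_mul_self_of_rank (hA hk), one_mulVec] at h1

/-- Both matrices are Kronecker products over the children, with factors s_w Û_w and s_w U_w R_w.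
Each factor has norm at most ‖s_w‖ and each difference at most ‖s_w‖ η. -/
theorem opNorm_systemA_sub_le (s : ∀ k, Core τ n l k) (t : ∀ k, Core τ n m k) (p p' : Tensor n)
    (D D' : SVDChoice τ n l m r) {k : V} {R : ∀ k, Matrix (Fin (r k)) (Fin (r k)) ℝ}
    (hR : ∀ k, (R k)ᵀ * R k = 1)
    (hZ : ∀ w ∈ τ.children k, sketchZ τ s t p w * D.Q w = D.U w ∧ (D.U w)ᵀ * D.U w = 1)
    (hZ' : ∀ w ∈ τ.children k, sketchZ τ s t p' w * D'.Q w = D'.U w ∧ (D'.U w)ᵀ * D'.U w = 1)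
    {η : ℝ} (hη : 0 ≤ η) (hU : ∀ w ∈ τ.children k, ‖D'.U w - D.U w * R w‖ ≤ η) :
    ‖systemA τ s t p' D' k - systemA τ s t p D k * piKronecker fun w : τ.children k => R w‖ ≤
      cC τ * (η * cS τ s k) := by
  have h1 : systemA τ s t p D k * (piKronecker fun w : τ.children k => R w) =
      piKronecker fun w : τ.children k => sketchCoreMatrix τ (s w) * (D.U w * R w) := by
    rw [systemA_eq_piKronecker, piKronecker_mul]
    congr 1
    funext w
    rw [sketchEdgeZ_eq_mul, Matrix.mul_assoc (sketchCoreMatrix τ (s w)), (hZ w w.2).1,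
      Matrix.mul_assoc]
  have h2 : systemA τ s t p' D' k =
      piKronecker fun w : τ.children k => sketchCoreMatrix τ (s w) * D'.U w := by
    rw [systemA_eq_piKronecker]
    congr 1
    funext w
    rw [sketchEdgeZ_eq_mul, Matrix.mul_assoc, (hZ' w w.2).1]
  rw [h1, h2, cS_eq_prod]
  refine (opNorm_piKronecker_sub_le (c := fun w : τ.children k => ‖sketchCoreMatrix τ (s w)‖)
    (η := η) (fun w => ?_) (fun w => ?_) (fun w => ?_)).trans ?_
  · refine (l2_opNorm_mul _ _).trans (mul_le_of_le_one_right (norm_nonneg _) ?_)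
    exact opNorm_le_one_of_transpose_mul_self (hZ' w w.2).2
  · refine (l2_opNorm_mul _ _).trans (mul_le_of_le_one_right (norm_nonneg _) ?_)
    refine opNorm_le_one_of_transpose_mul_self ?_
    rw [transpose_mul, Matrix.mul_assoc, ← Matrix.mul_assoc (D.U w)ᵀ, (hZ w w.2).2,
      Matrix.one_mul, hR]
  · rw [← Matrix.mul_sub]
    exact (l2_opNorm_mul _ _).trans (mul_le_mul_of_nonneg_left (hU w w.2) (norm_nonneg _))
  · rw [Fintype.card_coe]
    refine mul_le_mul_of_nonneg_right (Nat.cast_le.2 (card_children_le_cC τ k))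
      (mul_nonneg hη (Finset.prod_nonneg fun _ _ => norm_nonneg _))

/-- The slice of the right-hand side `B_k` at a physical index. -/
def sliceB {k : V} (B : Matrix (Joint l (τ.children k) × Fin (n k)) (Fin (r k)) ℝ)
    (x : Fin (n k)) : Matrix (Joint l (τ.children k)) (Fin (r k)) ℝ :=
  B.submatrix (fun β => (β, x)) id

/-- Perturbation of one core. -/
theorem triNorm_sub_rotateCore_le (s : ∀ k, Core τ n l k) (t : ∀ k, Core τ n m k)
    (p p' : Tensor n) (D D' : SVDChoice τ n l m r) {G G' : ∀ k, Core τ n r k} {k : V}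
    {R : ∀ k, Matrix (Fin (r k)) (Fin (r k)) ℝ} (hR : ∀ k, (R k)ᵀ * R k = 1)
    (hR' : ∀ k, R k * (R k)ᵀ = 1)
    (hA : ¬ τ.IsLeaf k → (systemA τ s t p D k).rank = Fintype.card (Joint r (τ.children k)))
    (hAB : systemA τ s t p D k * coreMatrix τ (G k) = systemB' τ s t p D k)
    (hAB' : (systemA τ s t p' D' k)ᵀ *
      (systemA τ s t p' D' k * coreMatrix τ (G' k) - systemB' τ s t p' D' k) = 0)
    (hG : 0 < triNorm τ (G k)) {δ : ℝ} (hδ0 : 0 < δ) (hδ1 : δ < 1)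
    (hAA : ‖systemA τ s t p' D' k - systemA τ s t p D k *
      piKronecker fun w : τ.children k => R w‖ ≤ cS τ s k * (xi τ s t p D G * δ / 3))
    (hBB : ‖systemB τ s t p' D' k - systemB τ s t p D k * R k‖ ≤ xi τ s t p D G * δ / 3) :
    triNorm τ (G' k - rotateCore τ R (G k)) ≤ δ * triNorm τ (rotateCore τ R (G k)) := by
  rw [triNorm_rotateCore τ hR hR']
  set T := triNorm τ (G k) with hT
  set K := piKronecker fun w : τ.children k => R w with hK
  set A := systemA τ s t p D k
  set A' := systemA τ s t p' D' k
  have hKK : Kᵀ * K = 1 := piKronecker_orthogonal hR _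
  have hKK' : K * Kᵀ = 1 := piKronecker_orthogonal' hR' _
  refine triNorm_le τ (by positivity) fun x => ?_
  have hs : slice τ (G' k - rotateCore τ R (G k)) x =
    slice τ (G' k) x - slice τ (rotateCore τ R (G k)) x := rfl
  have h1 : A * slice τ (G k) x = sliceB τ (systemB τ s t p D k) x := by
    ext β a
    exact congrFun (congrFun hAB β) (x, a)
  -- The rotated core solves the rotated system exactly, since K Kᵀ = 1.
  have h2 : A * K * slice τ (rotateCore τ R (G k)) x =
      sliceB τ (systemB τ s t p D k * R k) x := by
    have : sliceB τ (systemB τ s t p D k * R k) x = sliceB τ (systemB τ s t p D k) x * R k := rfl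
    rw [this, ← h1, slice_rotateCore, ← hK, Matrix.mul_assoc Kᵀ, Matrix.mul_assoc A,
      ← Matrix.mul_assoc K, hKK', Matrix.one_mul, Matrix.mul_assoc]
  have h3 : A'ᵀ * (A' * slice τ (G' k) x - sliceB τ (systemB τ s t p' D' k) x) = 0 := by
    ext α a
    exact congrFun (congrFun hAB' α) (x, a)
  have h4 : ∀ v : Joint r (τ.children k) → ℝ, ‖WithLp.toLp 2 v‖ ≤
      cA τ s t p D k * ‖WithLp.toLp 2 ((A * K) *ᵥ v)‖ := fun v => by
    have h5 : ‖WithLp.toLp 2 v‖ ≤ ‖WithLp.toLp 2 (K *ᵥ v)‖ := by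
      refine le_of_sq_le_sq ?_ (norm_nonneg _)
      rw [norm_toLp_sq, norm_toLp_sq, mulVec_dotProduct_mulVec, hKK, one_mulVec]
    rw [← mulVec_mulVec]
    exact h5.trans (norm_le_cA_mul τ s t p D hA _)
  have hcA := cA_nonneg τ s t p D k
  have hcS := cS_nonneg τ s k
  have hcG := cG_nonneg τ (G k)
  have hxi := xi_nonneg τ s t p D G
  have hmul := mul_xi_le_one τ s t p D G k
  have hGT : cG τ (G k) * T = 1 := by rw [cG, ← hT, one_div, inv_mul_cancel₀ hG.ne']
  set a := cA τ s t p D k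
  set b := cS τ s k
  set g := cG τ (G k)
  set ξ := xi τ s t p D G
  -- The smallness required for the least-squares bound: 2abξ ≤ 1 and δ < 1.
  have h6 : a * (b * (ξ * δ / 3)) ≤ 1 / 6 := by
    have e1 : a * b * ξ ≤ 1 / 2 := by
      have : 0 ≤ a * g * ξ := by positivity
      linarith
    have e2 : a * b * ξ * δ ≤ 1 / 2 * 1 := by gcongr
    linarith
  have h7 := opNorm_sub_le_of_normal_eq hcA h4 hAA h6 h2 h3
  rw [hs]
  refine h7.trans ?_
  have h8 : ‖sliceB τ (systemB τ s t p' D' k) x - sliceB τ (systemB τ s t p D k * R k) x‖ ≤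
      ξ * δ / 3 := by
    refine le_trans ?_ hBB
    exact opNorm_submatrix_le (systemB τ s t p' D' k - systemB τ s t p D k * R k)
      (f := fun β => (β, x)) fun _ _ h => (Prod.mk.inj h).1
  have h9 : ‖slice τ (rotateCore τ R (G k)) x‖ ≤ T := by
    rw [hT, ← triNorm_rotateCore τ hR hR' (G k)]
    exact opNorm_slice_le τ _ x
  calc 6 / 5 * a * (_ + b * (ξ * δ / 3) * ‖slice τ (rotateCore τ R (G k)) x‖)
      ≤ 6 / 5 * a * (ξ * δ / 3 + b * (ξ * δ / 3) * T) := by gcongr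
    -- Since g T = 1, the absolute error of B_k becomes relative to T and joins the error of A_k in
    -- the factor b + g that ξ controls.
    _ = 1 / 5 * δ * T * (2 * a * (b + g) * ξ) + 2 / 5 * a * ξ * δ * (1 - g * T) := by ring
    _ = 1 / 5 * δ * T * (2 * a * (b + g) * ξ) := by rw [hGT]; ring
    _ ≤ 1 / 5 * δ * T * 1 := by gcongr
    _ ≤ δ * T := by nlinarith [mul_pos hδ0 hG]

end ErrorBound

end

/-! ### Assembly of the error bound. -/

theorem mainTheorem5 (d : ℕ) (hd : 2 ≤ d) (τ : TTNSTree (Fin d))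
    -- physical dimensions; bond ranks of the cores; bond dimensions of the left and right sketches
    (n r l m : Fin d → ℕ)
    -- the dummy bond above the root has size one
    (hr : r τ.root = 1) (hl : l τ.root = 1) (hm : m τ.root = 1)
    -- the density and the input of the algorithm, e.g. an empirical distribution
    (pstar phat : Tensor n)
    (hp_nonneg : ∀ x, 0 ≤ pstar x) (hp_sum : ∑ x, pstar x = 1)
    (hp : TTNSCondition τ r pstar)
    -- sketch cores
    (s : ∀ k, Core τ n l k) (t : ∀ k, Core τ n m k)
    (hst : SketchCondition τ r s t pstar)
    (Dstar Dhat : SVDChoice τ n l m r) (Gstar Ghat : ∀ k, Core τ n r k)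
    (hstar : IsSketchOutput τ s t pstar Dstar Gstar)
    (hhat : IsSketchOutput τ s t phat Dhat Ghat)
    (δ : ℝ) (hδ0 : 0 < δ) (hδ1 : δ < 1)
    (hZ : ∀ k, ‖sketchZ τ s t pstar k - sketchZ τ s t phat k‖ ≤
      zeta τ s t pstar Dstar Gstar k * δ) :
    ∃ (R : ∀ k, Matrix (Fin (r k)) (Fin (r k)) ℝ) (Gcirc : ∀ k, Core τ n r k),
      (∀ k, R k ∈ Matrix.orthogonalGroup (Fin (r k)) ℝ) ∧ R τ.root = 1 ∧
      (∀ k, Gcirc k = rotateCore τ R (Gstar k)) ∧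
      IsTTNS τ pstar Gcirc ∧
      (∀ k, triNorm τ (Gcirc k) = triNorm τ (Gstar k)) ∧
      (∀ k, 0 < triNorm τ (Gcirc k)) ∧
      ∀ k, triNorm τ (Ghat k - Gcirc k) ≤ δ * triNorm τ (Gcirc k) := by
  have : Nontrivial (Fin d) := Fin.nontrivial_iff_two_le.2 hd
  have hp0 : pstar ≠ 0 := by
    rintro rfl
    simp at hp_sum
  have hn : ∀ v, 0 < n v := by
    obtain ⟨x, -⟩ := Function.ne_iff.1 hp0
    exact fun v => (x v).pos
  have hr0 := bond_pos τ hr hp0 hp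
  have hl0 := sketch_bond_pos τ hl hr0 hp hst
  obtain ⟨hroot, hrec, hArank, hAB⟩ := hstar.recovery τ hm hn hl0 hr0 hp hst
  have hrk : ∀ k, k ≠ τ.root → (sketchZ τ s t pstar k).rank = r k := fun k hk =>
    (rank_sketchZ_eq τ hl0 hst hp hk).1
  have hc : (1 : ℝ) ≤ cC τ := by exact_mod_cast one_le_cC τ
  have hxi0 := xi_nonneg τ s t pstar Dstar Gstar
  have hxi1 := xi_le_one τ s t pstar Dstar Gstar
  set ξ := xi τ s t pstar Dstar Gstar with hξ
  -- Chosen so that ζ_k δ = c_{k;Z} e. The c_C in the denominator pays for the telescoping over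
  -- children; as c_C ≥ 1, the error 2e of B_k is within ξδ/3 too.
  set e : ℝ := ξ * δ / (6 * cC τ) with he
  have he0 : 0 ≤ e := by positivity
  have he1 : 2 * e * cC τ = ξ * δ / 3 := by rw [he]; field_simp; ring
  have he2 : 2 * e ≤ ξ * δ / 3 := by rw [← he1]; exact le_mul_of_one_le_right (by positivity) hc
  have he3 : e ≤ 1 / 6 := by
    have : ξ * δ ≤ 1 * 1 := by gcongr
    linarith
  have hZe : ∀ k, ‖sketchZ τ s t pstar k - sketchZ τ s t phat k‖ ≤ cZ τ r s t pstar k * e := by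
    intro k
    refine (hZ k).trans_eq ?_
    rw [zeta, ← hξ, he, mul_inv, inv_div, mul_assoc]
    field_simp
  have hZs : ∀ k, k ≠ τ.root → ‖sketchZ τ s t pstar k - sketchZ τ s t phat k‖ ≤
      sigma (r k) (sketchZ τ s t pstar k) * e := fun k hk => by
    have := hZe k
    rwa [cZ, if_neg hk] at this
  -- Weyl's inequality keeps the computed singular values positive, so Q̂_k really inverts Σ̂_k and
  -- Ẑ_k Q̂_k = Û_k.
  have hσhat : ∀ k, k ≠ τ.root → ∀ i, 0 < Dhat.σ k i := fun k hk i => by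
    have h1 := (hhat.svd k hk).sigma_le (Z := sketchZ τ s t pstar k) i
    have h2 := sigma_pos_of_rank (hr0 k) (hrk k hk)
    have h3 := hZs k hk
    nlinarith
  have hex : ∀ k, ∃ R ∈ Matrix.orthogonalGroup (Fin (r k)) ℝ, (k = τ.root → R = 1) ∧
      (k ≠ τ.root → ‖Dhat.U k - Dstar.U k * R‖ ≤ 2 * e) := by
    intro k
    by_cases hk : k = τ.root
    · exact ⟨1, one_mem _, fun _ => rfl, fun h => absurd hk h⟩
    · obtain ⟨R, hR, hle⟩ := (hstar.svd k hk).exists_orthogonal_opNorm_sub_le (hr0 k)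
        (hhat.svd k hk) (hrk k hk) he3 (hZs k hk)
      exact ⟨R, hR, fun h => absurd h hk, fun _ => hle⟩
  choose R hRorth hRroot hRU using hex
  have hR : ∀ k, (R k)ᵀ * R k = 1 := fun k => (Matrix.mem_orthogonalGroup_iff' _ _).1 (hRorth k)
  have hR' : ∀ k, R k * (R k)ᵀ = 1 := fun k => (Matrix.mem_orthogonalGroup_iff _ _).1 (hRorth k)
  have hstarσ : ∀ k, k ≠ τ.root → IsTruncatedSVD (sketchZ τ s t pstar k) (Dstar.U k) (Dstar.σ k)
      (Dstar.V k) ∧ ∀ i, 0 < Dstar.σ k i := fun k hk =>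
    ⟨hstar.svd k hk, ((hstar.svd k hk).of_rank_eq (hrk k hk)).1⟩
  have hTTNS : IsTTNS τ pstar Gstar := isTTNS_of_recursion τ hr hr0 hrec hroot
  have hpos := triNorm_pos_of_isTTNS τ hp0 hTTNS
  refine ⟨R, fun k => rotateCore τ R (Gstar k), hRorth, hRroot _ rfl, fun k => rfl, ?_,
    fun k => triNorm_rotateCore τ hR hR' _, fun k => ?_, fun k => ?_⟩
  · refine isTTNS_of_recursion τ hr hr0 (recursion_rotateCore τ hR' hrec) fun x a => ?_
    rw [hRroot _ rfl, Matrix.mul_one]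
    exact hroot x a
  · rw [triNorm_rotateCore τ hR hR']; exact hpos k
  · refine triNorm_sub_rotateCore_le τ s t pstar phat Dstar Dhat hR hR' (hArank k) (hAB k)
      (hhat.normal_eq τ hr0 k) (hpos k) hδ0 hδ1 ?_ ?_
    · refine (opNorm_systemA_sub_le τ s t pstar phat Dstar Dhat hR ?_ ?_
        (η := 2 * e) (by positivity) fun w hw => hRU w (τ.child_ne_root hw)).trans_eq ?_
      · intro w hw
        have h1 := hstarσ w (τ.child_ne_root hw)
        exact ⟨h1.1.mul_mul_diagonal_inv h1.2, h1.1.orthonormal_left⟩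
      · intro w hw
        have h1 := hhat.svd w (τ.child_ne_root hw)
        exact ⟨h1.mul_mul_diagonal_inv (hσhat w (τ.child_ne_root hw)), h1.orthonormal_left⟩
      · rw [← hξ, ← he1]; ring
    · refine le_trans ?_ he2
      -- At the root B_k is Z_k times a 1 × 1 matrix of norm at most 1, with c_{k;Z} = 1 and no
      -- rotation; elsewhere it is U_k.
      by_cases hk : k = τ.root
      · have h1 := hZe k
        rw [cZ, if_pos hk, one_mul, norm_sub_rev] at h1
        rw [systemB_eq_mul τ s t phat fun h => absurd hk h,
          systemB_eq_mul τ s t pstar fun h => absurd hk h, hRroot k hk, Matrix.mul_one]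
        have h2 : Dhat.extQ k = Dstar.extQ k := by simp [SVDChoice.extQ, hk]
        have h3 : ‖Dstar.extQ k‖ ≤ 1 := by
          refine opNorm_le_one_of_transpose_mul_self ?_
          subst hk
          have : Subsingleton (Fin (r τ.root)) := by rw [hr]; infer_instance
          ext a b
          obtain rfl : a = b := Subsingleton.elim _ _
          simp [SVDChoice.extQ, Matrix.mul_apply, hm]
        rw [h2, ← Matrix.sub_mul]
        refine (Matrix.l2_opNorm_mul _ _).trans ?_
        have := mul_le_mul h1 h3 (norm_nonneg _) he0
        linarith
      · rw [systemB, systemB, if_neg hk, if_neg hk]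
        exact hRU k hk
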